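/- Let $X=\{0,1,2,3\}^{\mathbb N}$ be the boundary of the $4$-ary tree (infinite words $x=\varepsilon_1\varepsilon_2\cdots$), with the ultrametric $d(x,y)=4^{-|x\wedge y|}$, where $|x\wedge y|$ is the length of the largest common prefix of $x\ne y$. Let $a_i,b_i\in(0,1)$ $(1\le i\le 4)$ with $\sum_i a_i=\sum_i b_i=1$ and let $(t_k)_{k\ge1}$ be integers with $t_1=1$, $t_k<t_{k+1}$ and $t_{k+1}/t_k\to\infty$. Let $\mu$ be the Borel probability measure on $X$ whose value on every cylinder is $$\mu([\varepsilon_1\cdots\varepsilon_n])=\prod_{j=1}^n p_j,\qquad p_j=\begin{cases}a_{\varepsilon_j+1}&\text{if }t_{2k-1}\le j<t_{2k}\text{ for some }k\ge1,\\ b_{\varepsilon_j+1}&\text{if }t_{2k}\le j<t_{2k+1}\text{ for some }k\ge1.\end{cases}$$ Definitions. $B(x,r)$ is the open ball and $K=\operatorname{supp}\mu$. For $q,t\in\mathbb R$ and $E\subseteq X$ let $N^q_{\mu,r}(E)$ be the infimum of $\sum_i\mu(B(x_i,r))^q$ over all coverings of $E$ by balls $B(x_i,r)$ with $x_i\in E$,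 and $M^q_{\mu,r}(E)$ the supremum of the same sums over all families of pairwise disjoint balls $B(x_i,r)$ with $x_i\in E$. Put $$\overline{\mathsf H}^{q,t}_\mu(E)=\sup_{F\subseteq E}\liminf_{r\to0}N^q_{\mu,r}(F)(2r)^t,\qquad \overline{\mathsf P}^{q,t}_\mu(E)=\limsup_{r\to0}M^q_{\mu,r}(E)(2r)^t,$$ $$\mathsf H^{q,t}_\mu(E)=\inf_{E\subseteq\bigcup_iE_i}\sum_i\overline{\mathsf H}^{q,t}_\mu(E_i),\qquad \mathsf P^{q,t}_\mu(E)=\inf_{E\subseteq\bigcup_iE_i}\sum_i\overline{\mathsf P}^{q,t}_\mu(E_i),$$ the infima being over countable covers. Let $\mathsf b_\mu(q)=\inf\{t\in\mathbb R:\mathsf H^{q,t}_\mu(K)=0\}$ and $\mathsf B_\mu(q)=\inf\{t\in\mathbb R:\mathsf P^{q,t}_\mu(K)=0\}$. The Hewitt–Stromberg measures $\mathsf H^t,\mathsf P^t$ are defined in the same way with every $\mu(B(x_i,r))^q$ replaced by $1$, and the lower and upper Hewitt–Stromberg dimensions are $\underline{\dim}_{MB}E=\sup\{t\ge0:\mathsf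 H^t(E)=\infty\}$ and $\overline{\dim}_{MB}E=\sup\{t\ge0:\mathsf P^t(E)=\infty\}$. $\dim_H$ and $\dim_P$ are the Hausdorff and packing dimensions. For $\chi:\mathbb R\to[-\infty,\infty]$ let $\chi^*(\alpha)=\inf_{q\in\mathbb R}(\alpha q+\chi(q))$. Finally $$E_\mu(\alpha)=\Big\{x\in K:\ \lim_{r\to0}\frac{\log\mu(B(x,r))}{\log r}=\alpha\Big\}.$$ Theorem. Suppose that $a_1<b_1$ and that the graph of $q\mapsto\log_4(a_1^q+a_2^q+a_3^q+a_4^q)$ lies on or above that of $q\mapsto\log_4(b_1^q+b_2^q+b_3^q+b_4^q)$, i.e. $\log_4\sum_{i=1}^4b_i^q\le\log_4\sum_{i=1}^4a_i^q$ for all $q\in\mathbb R$. Then for every $\alpha\in(-\log_4b_4,\,-\log_4b_1)$ $$\dim_HE_\mu(\alpha)=\underline{\dim}_{MB}E_\mu(\alpha)=\mathsf b_\mu^*(\alpha)\qquad\text{and}\qquad \dim_PE_\mu(\alpha)=\overline{\dim}_{MB}E_\mu(\alpha)=\mathsf B_\mu^*(\alpha).$$ -/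

import Mathlib

open MeasureTheory Filter Topology
open scoped ENNReal NNReal

noncomputable section

namespace HewittStromberg

/-! ### Packing measure and packing dimension -/

section General

variable {X : Type*} [MetricSpace X]

/-- A packing of `E` by balls of radius at most `δ`, given by its pairs (centre, radius):
pairwise disjoint open balls, centred in `E`, with radii in `(0, δ]`. -/
def IsPacking (δ : ℝ) (E : Set X) (s : Set (X × ℝ)) : Prop :=
  (∀ p ∈ s, p.1 ∈ E ∧ 0 < p.2 ∧ p.2 ≤ δ) ∧
    s.PairwiseDisjoint fun p => Metric.ball p.1 p.2

/-- The `δ`-packing number `sup ∑ (2 rᵢ) ^ t`. -/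
def packingPreDelta (t δ : ℝ) (E : Set X) : ℝ≥0∞ :=
  ⨆ (s : Set (X × ℝ)) (_ : IsPacking δ E s), ∑' p : s, ENNReal.ofReal (2 * p.1.2) ^ t

/-- The `t`-dimensional packing pre-measure: the (decreasing) limit of `packingPreDelta t δ E`
as `δ → 0`. -/
def packingPre (t : ℝ) (E : Set X) : ℝ≥0∞ :=
  ⨅ (δ : ℝ) (_ : 0 < δ), packingPreDelta t δ E

/-- Method I: `inf ∑ᵢ m (Eᵢ)` over all countable covers `(Eᵢ)` of `E`. -/
def methodI (m : Set X → ℝ≥0∞) (E : Set X) : ℝ≥0∞ :=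
  ⨅ (U : ℕ → Set X) (_ : E ⊆ ⋃ i, U i), ∑' i, m (U i)

/-- The `t`-dimensional packing measure. -/
def packingMeasure (t : ℝ) (E : Set X) : ℝ≥0∞ :=
  methodI (packingPre t) E

/-- The packing dimension. (The Hausdorff dimension is Mathlib's `dimH`.) -/
def dimP (E : Set X) : ℝ≥0∞ :=
  ⨆ (t : ℝ≥0) (_ : packingMeasure (t : ℝ) E = ∞), (t : ℝ≥0∞)

/-! ### Hewitt–Stromberg measures, plain and multifractal

Both are obtained from sums `∑ᵢ c (B (xᵢ, r))` over centred coverings and packings by balls of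
one and the same radius `r`. The plain (fractal) ones have `c = 1`, so that the sum is the number
of balls; the multifractal ones have `c B = μ(B) ^ q`. -/

/-- `inf ∑ᵢ c (B (xᵢ, r))` over all coverings of `E` by open balls `B (xᵢ, r)` with `xᵢ ∈ E`. -/
def coveringSum (c : Set X → ℝ≥0∞) (r : ℝ) (E : Set X) : ℝ≥0∞ :=
  ⨅ (s : Set X) (_ : s ⊆ E) (_ : E ⊆ ⋃ x ∈ s, Metric.ball x r),
    ∑' x : s, c (Metric.ball (x : X) r)

/-- `sup ∑ᵢ c (B (xᵢ, r))` over all families of pairwise disjoint open balls `B (xᵢ, r)` with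
`xᵢ ∈ E`. -/
def packingSum (c : Set X → ℝ≥0∞) (r : ℝ) (E : Set X) : ℝ≥0∞ :=
  ⨆ (s : Set X) (_ : s ⊆ E) (_ : s.PairwiseDisjoint fun x => Metric.ball x r),
    ∑' x : s, c (Metric.ball (x : X) r)

/-- `liminf_{r → 0} (coveringSum c r E) (2 r) ^ t`. -/
def lowerL (c : Set X → ℝ≥0∞) (t : ℝ) (E : Set X) : ℝ≥0∞ :=
  liminf (fun r : ℝ => coveringSum c r E * ENNReal.ofReal (2 * r) ^ t) (𝓝[>] 0)

/-- The lower pre-measure `sup_{F ⊆ E} lowerL c t F`. -/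
def lowerPre (c : Set X → ℝ≥0∞) (t : ℝ) (E : Set X) : ℝ≥0∞ :=
  ⨆ (F : Set X) (_ : F ⊆ E), lowerL c t F

/-- The upper pre-measure `limsup_{r → 0} (packingSum c r E) (2 r) ^ t`. -/
def upperPre (c : Set X → ℝ≥0∞) (t : ℝ) (E : Set X) : ℝ≥0∞ :=
  limsup (fun r : ℝ => packingSum c r E * ENNReal.ofReal (2 * r) ^ t) (𝓝[>] 0)

/-- The lower `t`-dimensional Hewitt–Stromberg measure. -/
def lowerHS (t : ℝ) (E : Set X) : ℝ≥0∞ := methodI (lowerPre (fun _ => 1) t) E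

/-- The upper `t`-dimensional Hewitt–Stromberg measure. -/
def upperHS (t : ℝ) (E : Set X) : ℝ≥0∞ := methodI (upperPre (fun _ => 1) t) E

/-- The lower Hewitt–Stromberg dimension (lower modified box dimension). -/
def lowerDimMB (E : Set X) : ℝ≥0∞ :=
  ⨆ (t : ℝ≥0) (_ : lowerHS (t : ℝ) E = ∞), (t : ℝ≥0∞)

/-- The upper Hewitt–Stromberg dimension (upper modified box dimension). -/
def upperDimMB (E : Set X) : ℝ≥0∞ :=
  ⨆ (t : ℝ≥0) (_ : upperHS (t : ℝ) E = ∞), (t : ℝ≥0∞)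

variable [MeasurableSpace X]

/-- The lower multifractal Hewitt–Stromberg measure of parameters `q`, `t`. -/
def lowerMultiHS (μ : Measure X) (q t : ℝ) (E : Set X) : ℝ≥0∞ :=
  methodI (lowerPre (fun B => μ B ^ q) t) E

/-- The upper multifractal Hewitt–Stromberg measure of parameters `q`, `t`. -/
def upperMultiHS (μ : Measure X) (q t : ℝ) (E : Set X) : ℝ≥0∞ :=
  methodI (upperPre (fun B => μ B ^ q) t) E

/-- The lower multifractal Hewitt–Stromberg function: `lowerMultiHS μ q · (supp μ)` is `∞` below
`bFun μ q` and `0` above it. -/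
def bFun (μ : Measure X) (q : ℝ) : EReal :=
  ⨅ (t : ℝ) (_ : lowerMultiHS μ q t μ.support = 0), (t : EReal)

/-- The upper multifractal Hewitt–Stromberg function: `upperMultiHS μ q · (supp μ)` is `∞` below
`BFun μ q` and `0` above it. -/
def BFun (μ : Measure X) (q : ℝ) : EReal :=
  ⨅ (t : ℝ) (_ : upperMultiHS μ q t μ.support = 0), (t : EReal)

/-- The lower local dimension of `μ` at `x`. -/
def lowerLocalDim (μ : Measure X) (x : X) : EReal :=
  liminf (fun r : ℝ => ((Real.log (μ.real (Metric.ball x r)) / Real.log r : ℝ) : EReal)) (𝓝[>] 0)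

/-- The upper local dimension of `μ` at `x`. -/
def upperLocalDim (μ : Measure X) (x : X) : EReal :=
  limsup (fun r : ℝ => ((Real.log (μ.real (Metric.ball x r)) / Real.log r : ℝ) : EReal)) (𝓝[>] 0)

/-- The level set of points of `supp μ` at which the local dimension of `μ` exists and
equals `α`. -/
def levelSet (μ : Measure X) (α : ℝ) : Set X :=
  {x ∈ μ.support | (α : EReal) ≤ lowerLocalDim μ x ∧ upperLocalDim μ x ≤ (α : EReal)}

end General

/-- The Legendre transform `χ^*(x) = inf_y (x y + χ(y))`. -/
def legendre (χ : ℝ → EReal) (x : ℝ) : EReal :=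
  ⨅ y : ℝ, (((x * y : ℝ) : EReal) + χ y)

/-! ### The boundary of the 4-ary tree -/

/-- The boundary of the 4-ary tree: infinite words on the alphabet `{0, 1, 2, 3}`. Here
`x.letter j` is the `(j + 1)`-st letter of the word `x`. -/
@[ext]
structure Boundary where
  letter : ℕ → Fin 4

namespace Boundary

/-- The length of the largest common prefix of two distinct infinite words. -/
def commonLength (x y : Boundary) : ℕ := PiNat.firstDiff (E := fun _ => Fin 4) x.letter y.letter

open Classical in
/-- The ultrametric `d(x, y) = 4 ^ (-|x ∧ y|)`. -/
instance : MetricSpace Boundary where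
  dist x y := if x = y then 0 else (1 / 4 : ℝ) ^ commonLength x y
  dist_self x := by simp
  dist_comm x y := by
    simp only [eq_comm (a := x), commonLength,
      PiNat.firstDiff_comm (E := fun _ => Fin 4) x.letter y.letter]
  dist_triangle x y z := by
    by_cases hxz : x = z
    · simp only [hxz, if_true]
      positivity
    by_cases hxy : x = y
    · simp [hxy]
    by_cases hyz : y = z
    · simp [hyz]
    simp only [hxz, hxy, hyz, if_false]
    have h := PiNat.min_firstDiff_le (E := fun _ => Fin 4) x.letter y.letter z.letter
      fun h => hxz (Boundary.ext h)
    have h1 : (0 : ℝ) ≤ (1 / 4 : ℝ) ^ commonLength x y := by positivity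
    have h2 : (0 : ℝ) ≤ (1 / 4 : ℝ) ^ commonLength y z := by positivity
    rcases min_le_iff.1 h with h | h
    · have := pow_le_pow_of_le_one (by norm_num : (0 : ℝ) ≤ 1 / 4) (by norm_num) h
      simp only [commonLength] at *
      linarith
    · have := pow_le_pow_of_le_one (by norm_num : (0 : ℝ) ≤ 1 / 4) (by norm_num) h
      simp only [commonLength] at *
      linarith
  eq_of_dist_eq_zero {x y} h := by
    by_contra hne
    simp [hne] at h

/-- The σ-algebra generated by the coordinates; it is the Borel σ-algebra. -/
instance : MeasurableSpace Boundary := MeasurableSpace.comap letter MeasurableSpace.pi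

/-- The cylinder `[w]` of all infinite words with prefix `w = ε₁ ⋯ εₙ`. -/
def cylinder {n : ℕ} (w : Fin n → Fin 4) : Set Boundary := {x | ∀ j : Fin n, x.letter j = w j}

lemma mem_cylinder {n : ℕ} (w : Fin n → Fin 4) (x : Boundary) :
    x ∈ cylinder w ↔ ∀ j : Fin n, x.letter j = w j := Iff.rfl

lemma ball_eq (x : Boundary) (n : ℕ) :
    Metric.ball x ((1 / 4 : ℝ) ^ n) = cylinder (fun j : Fin (n + 1) => x.letter j) := by
  classical
  ext y
  change (if y = x then (0 : ℝ) else (1 / 4 : ℝ) ^ commonLength y x) < (1 / 4 : ℝ) ^ n ↔ _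
  by_cases h : y = x
  · subst h
    simp [cylinder]
  · rw [if_neg h, pow_lt_pow_iff_right_of_lt_one₀ (by norm_num) (by norm_num),
      ← Nat.succ_le_iff, commonLength, ← PiNat.mem_cylinder_iff_le_firstDiff
        fun h' => h (Boundary.ext h')]
    rw [mem_cylinder, Fin.forall_iff]
    exact Iff.rfl

lemma measurable_letter : Measurable letter := comap_measurable _

lemma measurable_mk : Measurable mk :=
  measurable_comap_iff.2 measurable_id

lemma measurableSet_cylinder {n : ℕ} (w : Fin n → Fin 4) : MeasurableSet (cylinder w) := by
  have : cylinder w = ⋂ j : Fin n, (fun x : Boundary => x.letter j) ⁻¹' {w j} := by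
    ext x
    simp [mem_cylinder]
  rw [this]
  exact MeasurableSet.iInter fun j =>
    ((measurable_pi_apply _).comp measurable_letter) (measurableSet_singleton _)

lemma isOpen_iff (s : Set Boundary) :
    IsOpen s ↔ ∀ x ∈ s, ∃ n : ℕ, cylinder (fun j : Fin (n + 1) => x.letter j) ⊆ s := by
  rw [Metric.isOpen_iff]
  refine forall₂_congr fun x _ => ⟨fun ⟨ε, hε, h⟩ => ?_, fun ⟨n, h⟩ =>
    ⟨(1 / 4 : ℝ) ^ n, by positivity, by rwa [ball_eq]⟩⟩
  obtain ⟨n, hn⟩ := exists_pow_lt_of_lt_one hε (by norm_num : (1 / 4 : ℝ) < 1)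
  exact ⟨n, by rw [← ball_eq]; exact (Metric.ball_subset_ball hn.le).trans h⟩

instance : BorelSpace Boundary where
  measurable_eq := by
    apply le_antisymm
    · refine Measurable.comap_le ?_
      refine @measurable_pi_lambda _ _ _ (borel Boundary) _ _ fun j s _ => ?_
      refine MeasurableSpace.measurableSet_generateFrom ?_
      refine (isOpen_iff _).2 fun x hx => ⟨j, fun y hy => ?_⟩
      have h : y.letter j = x.letter j := hy ⟨j, Nat.lt_succ_self j⟩
      change y.letter j ∈ s
      rw [h]
      exact hx
    · refine MeasurableSpace.generateFrom_le fun s hs => ?_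
      have : s = ⋃ (p : Σ n : ℕ, (Fin n → Fin 4)) (_ : cylinder p.2 ⊆ s), cylinder p.2 := by
        ext x
        simp only [Set.mem_iUnion]
        constructor
        · intro hx
          obtain ⟨n, hn⟩ := (isOpen_iff s).1 hs x hx
          exact ⟨⟨n + 1, fun j => x.letter j⟩, hn, fun _ => rfl⟩
        · rintro ⟨p, hp, hx⟩
          exact hp hx
      rw [this]
      exact MeasurableSet.iUnion fun p => MeasurableSet.iUnion fun _ =>
        measurableSet_cylinder p.2

end Boundary

/-! ### The block measure -/

open Classical in
/-- The weights used at position `j ≥ 1`: the vector `a` if `t_{2k-1} ≤ j < t_{2k}` for some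
`k ≥ 1`, and the vector `b` otherwise, that is (when `t_1 = 1` and `t` increases to infinity) if
`t_{2k} ≤ j < t_{2k+1}` for some `k ≥ 1`. -/
def blockWeight (a b : Fin 4 → ℝ) (t : ℕ → ℕ) (j : ℕ) : Fin 4 → ℝ :=
  if ∃ k : ℕ, 1 ≤ k ∧ t (2 * k - 1) ≤ j ∧ j < t (2 * k) then a else b

/-- The measure on the alphabet with weights `p`. -/
def letterMeasure (p : Fin 4 → ℝ) : Measure (Fin 4) :=
  ∑ i, ENNReal.ofReal (p i) • Measure.dirac i

/-- The measure on the boundary under which the letters are independent, the `j`-th one being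
distributed according to `blockWeight a b t j` (`j ≥ 1`). -/
def blockMeasure (a b : Fin 4 → ℝ) (t : ℕ → ℕ) : Measure Boundary :=
  (Measure.infinitePi fun j : ℕ => letterMeasure (blockWeight a b t (j + 1))).map Boundary.mk

lemma letterMeasure_singleton (p : Fin 4 → ℝ) (i : Fin 4) :
    letterMeasure p {i} = ENNReal.ofReal (p i) := by
  simp [letterMeasure, Measure.dirac_apply', Set.indicator_apply]

lemma isProbabilityMeasure_letterMeasure {p : Fin 4 → ℝ} (h0 : ∀ i, 0 ≤ p i)
    (h1 : ∑ i, p i = 1) : IsProbabilityMeasure (letterMeasure p) := by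
  constructor
  simp [letterMeasure, ← ENNReal.ofReal_sum_of_nonneg fun i _ => h0 i, h1]

/-- `μ[ε₁ ⋯ εₙ] = p₁ ⋯ pₙ`. -/
lemma blockMeasure_cylinder {a b : Fin 4 → ℝ} (ha : ∀ i, 0 ≤ a i) (hb : ∀ i, 0 ≤ b i)
    (ha1 : ∑ i, a i = 1) (hb1 : ∑ i, b i = 1) (t : ℕ → ℕ) {n : ℕ} (w : Fin n → Fin 4) :
    blockMeasure a b t (Boundary.cylinder w) =
      ∏ j : Fin n, ENNReal.ofReal (blockWeight a b t (j + 1) (w j)) := by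
  have hP : ∀ j : ℕ, IsProbabilityMeasure (letterMeasure (blockWeight a b t (j + 1))) := by
    intro j
    unfold blockWeight
    split_ifs
    · exact isProbabilityMeasure_letterMeasure ha ha1
    · exact isProbabilityMeasure_letterMeasure hb hb1
  have hc : Boundary.mk ⁻¹' Boundary.cylinder w = Set.pi (Finset.range n : Set ℕ)
      fun j => {i : Fin 4 | ∀ h : j < n, i = w ⟨j, h⟩} := by
    ext x
    rw [Set.mem_preimage, Boundary.mem_cylinder, Fin.forall_iff]
    exact ⟨fun h j _ hj => h j hj, fun h j hj => h j (Finset.mem_coe.2 (Finset.mem_range.2 hj)) hj⟩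
  rw [blockMeasure, Measure.map_apply Boundary.measurable_mk (Boundary.measurableSet_cylinder w), hc]
  refine (Measure.infinitePi_pi _ fun j _ => DiscreteMeasurableSpace.forall_measurableSet _).trans ?_
  rw [← Fin.prod_univ_eq_prod_range
    (fun j => letterMeasure (blockWeight a b t (j + 1)) {i : Fin 4 | ∀ h : j < n, i = w ⟨j, h⟩})]
  refine Finset.prod_congr rfl fun j _ => ?_
  rw [← letterMeasure_singleton]
  congr 1
  ext i
  simp

end HewittStromberg

end

open HewittStromberg

/-! Write P_p(q) = log_4 Σ p_i^q (`pressure`). Balls are cylinders, so every quantity is an estimate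
on cylinders. For fixed q let ν_q be the product measure with the same blocks as μ and with the
normalised weights a_i^q, b_i^q. Then μ(C)^q = 4^(S_n) ν_q(C) on each cylinder C of length n, where
S_n adds P_a(q) for each position in an a-block and P_b(q) for each position in a b-block
(`blockMeasure_pre_rpow`). As t_{k+1}/t_k → ∞, the last block dominates: S_n/n tends to P_a(q) along
the ends of the a-blocks and to P_b(q) along the ends of the b-blocks, and it always lies between
P_b(q) and P_a(q) (`tendsto_blockSum`). Counting with ν_q then gives 𝖻_μ = P_b, from the liminf, and
𝖡_μ = P_a, from the limsup.

Upper bounds: on the level set, up to a countable decomposition, ν_q(C) ≥ 4^(-(S_n + n(αq + ε))), so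
at most 4^(S_n + n(αq + ε)) disjoint cylinders of length n meet a piece. The ends of the b-blocks
bound the Hausdorff and lower Hewitt–Stromberg dimensions by αq + P_b(q); all n together bound the
packing dimension by αq + P_a(q).

Lower bounds: let q₀ minimise αq + P_b(q) and q₁ minimise αq + P_a(q). Vanishing of the derivative
says that α is the mean of -log_4 of the letter weight, for the b-weights tilted by q₀ and for the
a-weights tilted by q₁ (`exists_min_pressure`). The product measure tilted by q₁ in the a-blocks and
by q₀ in the b-blocks therefore lives on the level set, by the strong law, and its cylinders have
size 4^(-(T_n + o(n))), where T_n adds the two minimal values blockwise. The b-minimum is the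
smaller one, so it bounds T_n/n below for all n, which gives the lower dimensions; the ends of the
a-blocks give the upper ones. -/

namespace HewittStromberg

/-! ### Set functions obtained by Method I -/

section MethodI

variable {X : Type*}

lemma methodI_mono {m m' : Set X → ℝ≥0∞} (h : ∀ U, m U ≤ m' U) (E : Set X) :
    methodI m E ≤ methodI m' E :=
  iInf₂_mono fun _ _ => ENNReal.tsum_le_tsum fun _ => h _

lemma methodI_eq_zero {m : Set X → ℝ≥0∞} {E : Set X} (U : ℕ → Set X) (hE : E ⊆ ⋃ i, U i)
    (h : ∀ i, m (U i) = 0) : methodI m E = 0 :=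
  le_antisymm (iInf_le_of_le U (iInf_le_of_le hE (by simp [h]))) zero_le

/-- By countable subadditivity some member of any cover charges `E`, and one infinite term suffices.
Only the outer measure is used, so no set has to be measurable. -/
lemma methodI_eq_top [MeasurableSpace X] {m : Set X → ℝ≥0∞} {E : Set X} (ν : Measure X)
    (hE : ν E ≠ 0) (h : ∀ U, ν (U ∩ E) ≠ 0 → m U = ∞) : methodI m E = ∞ := by
  refine top_le_iff.1 (le_iInf fun U => le_iInf fun hU => ?_)
  have : ∃ i, ν (U i ∩ E) ≠ 0 := by
    by_contra! hc
    refine hE (le_antisymm ?_ zero_le)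
    calc ν E ≤ ν (⋃ i, U i ∩ E) := by
          rw [← Set.iUnion_inter]
          exact measure_mono fun x hx => ⟨hU hx, hx⟩
      _ = 0 := measure_iUnion_null hc
  obtain ⟨i, hi⟩ := this
  rw [← h _ hi]
  exact ENNReal.le_tsum i

end MethodI

/-! ### Covering and packing sums in metric and ultrametric spaces -/

section General

variable {X : Type*} [MetricSpace X]

lemma packingSum_le_mul_measure [MeasurableSpace X] [OpensMeasurableSpace X] (ν : Measure X)
    {c : Set X → ℝ≥0∞} {r : ℝ} {E : Set X} {M : ℝ≥0∞}
    (h : ∀ x ∈ E, c (Metric.ball x r) ≤ M * ν (Metric.ball x r)) :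
    packingSum c r E ≤ M * ν Set.univ := by
  refine iSup_le fun s => iSup_le fun hs => iSup_le fun hd => ?_
  calc ∑' x : s, c (Metric.ball (x : X) r)
      ≤ ∑' x : s, M * ν (Metric.ball (x : X) r) := ENNReal.tsum_le_tsum fun x => h x (hs x.2)
    _ = M * ∑' x : s, ν (Metric.ball (x : X) r) := ENNReal.tsum_mul_left
    _ ≤ M * ν Set.univ := by
        gcongr
        refine (tsum_meas_le_meas_iUnion_of_disjoint ν
          (As := fun x : s => Metric.ball (x : X) r) (fun x => measurableSet_ball) ?_).trans
          (measure_mono (Set.subset_univ _))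
        exact fun x y hxy => hd x.2 y.2 fun h => hxy (Subtype.ext h)

/-- The set of centres may be uncountable; the Lindelöf property yields a countable subfamily with
the same union, to which subadditivity applies. -/
lemma mul_measure_le_coveringSum [SecondCountableTopology X] [MeasurableSpace X]
    (ν : Measure X) {c : Set X → ℝ≥0∞} {r : ℝ} {E : Set X} {M : ℝ≥0∞}
    (h : ∀ x ∈ E, M * ν (Metric.ball x r) ≤ c (Metric.ball x r)) :
    M * ν E ≤ coveringSum c r E := by
  refine le_iInf fun s => le_iInf fun hs => le_iInf fun hc => ?_
  obtain ⟨T, hT, hTc, hTU⟩ := TopologicalSpace.isOpen_biUnion_countable s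
    (fun x => Metric.ball x r) fun _ _ => Metric.isOpen_ball
  calc M * ν E ≤ M * ν (⋃ x ∈ T, Metric.ball x r) := by
        gcongr
        rwa [hTU]
    _ ≤ M * ∑' x : T, ν (Metric.ball (x : X) r) := by
        gcongr
        exact measure_biUnion_le ν hTc _
    _ = ∑' x : T, M * ν (Metric.ball (x : X) r) := ENNReal.tsum_mul_left.symm
    _ ≤ ∑' x : T, c (Metric.ball (x : X) r) :=
        ENNReal.tsum_le_tsum fun x => h x (hs (hT x.2))
    _ ≤ ∑' x : s, c (Metric.ball (x : X) r) :=
        ENNReal.tsum_mono_subtype (fun x => c (Metric.ball x r)) hT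

lemma packingSum_mono (c : Set X → ℝ≥0∞) (r : ℝ) {E F : Set X} (h : E ⊆ F) :
    packingSum c r E ≤ packingSum c r F :=
  iSup_mono fun _ => iSup_le fun hs => le_iSup_of_le (hs.trans h) le_rfl

lemma upperPre_mono (c : Set X → ℝ≥0∞) (t : ℝ) {E F : Set X} (h : E ⊆ F) :
    upperPre c t E ≤ upperPre c t F :=
  limsup_le_limsup (Eventually.of_forall fun r => mul_le_mul_left (packingSum_mono c r h) _)

/-- Ultrametric balls of equal radius coincide or are disjoint, so one centre per distinct ball
gives a packing that is also a covering. -/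
lemma exists_disjoint_ball_cover [IsUltrametricDist X] {r : ℝ} (hr : 0 < r) (E : Set X) :
    ∃ s ⊆ E, (s.PairwiseDisjoint fun x => Metric.ball x r) ∧ E ⊆ ⋃ x ∈ s, Metric.ball x r := by
  obtain ⟨s, hs, hb⟩ := Set.exists_subset_bijOn E fun x => Metric.ball x r
  refine ⟨s, hs, fun x hx y hy hxy => ?_, fun x hx => ?_⟩
  · rcases IsUltrametricDist.ball_eq_or_disjoint x y r with h | h
    · exact absurd (hb.injOn hx hy h) hxy
    · exact h
  · obtain ⟨y, hy, hyx⟩ := hb.surjOn ⟨x, hx, rfl⟩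
    refine Set.mem_biUnion hy ?_
    change x ∈ (fun x => Metric.ball x r) y
    rw [hyx]
    exact Metric.mem_ball_self hr

lemma le_packingSum (c : Set X → ℝ≥0∞) {r : ℝ} {E s : Set X} (hs : s ⊆ E)
    (hd : s.PairwiseDisjoint fun x => Metric.ball x r) :
    ∑' x : s, c (Metric.ball (x : X) r) ≤ packingSum c r E := by
  unfold packingSum
  refine le_iSup_of_le s ?_
  rw [iSup_pos hs, iSup_pos hd]

lemma coveringSum_le (c : Set X → ℝ≥0∞) {r : ℝ} {E s : Set X} (hs : s ⊆ E)
    (hc : E ⊆ ⋃ x ∈ s, Metric.ball x r) :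
    coveringSum c r E ≤ ∑' x : s, c (Metric.ball (x : X) r) := by
  unfold coveringSum
  refine iInf_le_of_le s ?_
  rw [iInf_pos hs, iInf_pos hc]

lemma coveringSum_le_packingSum [IsUltrametricDist X] (c : Set X → ℝ≥0∞) {r : ℝ} (hr : 0 < r)
    (E : Set X) : coveringSum c r E ≤ packingSum c r E := by
  obtain ⟨s, hs, hd, hc⟩ := exists_disjoint_ball_cover hr E
  exact (coveringSum_le c hs hc).trans (le_packingSum c hs hd)

/-- A packing by balls of one radius r ≤ δ is a particular δ-packing. -/
lemma upperPre_one_le_packingPre (t : ℝ) (E : Set X) :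
    upperPre (fun _ => 1) t E ≤ packingPre t E := by
  refine le_iInf fun δ => le_iInf fun hδ => ?_
  refine limsup_le_of_le (h := ?_)
  filter_upwards [Ioc_mem_nhdsGT hδ] with r hr
  rw [packingSum, ENNReal.iSup_mul]
  refine iSup_le fun s => ?_
  rw [ENNReal.iSup_mul]
  refine iSup_le fun hs => ?_
  rw [ENNReal.iSup_mul]
  refine iSup_le fun hd => ?_
  have hp : IsPacking δ E ((fun x => (x, r)) '' s) := by
    refine ⟨?_, ?_⟩
    · rintro _ ⟨x, hx, rfl⟩
      exact ⟨hs hx, hr.1, hr.2⟩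
    · rintro _ ⟨x, hx, rfl⟩ _ ⟨y, hy, rfl⟩ hxy
      exact hd hx hy fun h => hxy (by rw [h])
  refine le_trans (le_of_eq ?_) (le_iSup_of_le _ (le_iSup (fun _ => _) hp))
  rw [← ENNReal.tsum_mul_right, tsum_image (fun p : X × ℝ => ENNReal.ofReal (2 * p.2) ^ t)
    fun x _ y _ h => (Prod.mk.inj h).1]
  simp only [one_mul]

lemma upperDimMB_le_dimP (E : Set X) : upperDimMB E ≤ dimP E := by
  refine iSup_mono fun t => iSup_le fun h => le_iSup_of_le (top_le_iff.1 ?_) le_rfl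
  rw [← h]
  exact methodI_mono (fun U => upperPre_one_le_packingPre _ U) E

/-- The packing sum is monotone in the set, which centred covering sums need not be; it thus
controls all subsets `F` in the supremum at once. -/
lemma lowerPre_eq_zero {c : Set X → ℝ≥0∞} {t : ℝ} {E : Set X} [IsUltrametricDist X]
    (h : liminf (fun r : ℝ => packingSum c r E * ENNReal.ofReal (2 * r) ^ t) (𝓝[>] 0) = 0) :
    lowerPre c t E = 0 := by
  refine le_antisymm (iSup_le fun F => iSup_le fun hF => ?_) zero_le
  rw [← h]
  refine liminf_le_liminf ?_
  filter_upwards [self_mem_nhdsWithin] with r hr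
  exact mul_le_mul_left ((coveringSum_le_packingSum c hr F).trans (packingSum_mono c r hF)) _

lemma hausdorffMeasure_eq_zero_of_liminf_packingSum [IsUltrametricDist X] [MeasurableSpace X]
    [BorelSpace X] [SecondCountableTopology X] {t : ℝ} (ht : 0 ≤ t) {E : Set X}
    (h : liminf (fun r : ℝ => packingSum (fun _ => 1) r E * ENNReal.ofReal (2 * r) ^ t)
      (𝓝[>] 0) = 0) : μH[t] E = 0 := by
  -- Stated for every real r, with the empty family when r ≤ 0, so that the chosen index types are
  -- countable without a side condition.
  have hex : ∀ r : ℝ, ∃ s : Set X, s.Countable ∧ (0 < r → s ⊆ E ∧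
      (s.PairwiseDisjoint fun x => Metric.ball x r) ∧ E ⊆ ⋃ x ∈ s, Metric.ball x r) := by
    intro r
    by_cases hr : 0 < r
    · obtain ⟨s, hs, hd, hc⟩ := exists_disjoint_ball_cover hr E
      exact ⟨s, hd.countable_of_isOpen (fun _ _ => Metric.isOpen_ball)
        (fun x _ => ⟨x, Metric.mem_ball_self hr⟩), fun _ => ⟨hs, hd, hc⟩⟩
    · exact ⟨∅, Set.countable_empty, fun h => absurd h hr⟩
  choose s hsc hs using hex
  have : ∀ r, Countable (s r) := fun r => (hsc r).to_subtype
  have hlim : Tendsto (fun r : ℝ => ENNReal.ofReal (2 * r)) (𝓝[>] 0) (𝓝 0) := by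
    have : Tendsto (fun r : ℝ => ENNReal.ofReal (2 * r)) (𝓝 0) (𝓝 (ENNReal.ofReal (2 * 0))) :=
      ENNReal.tendsto_ofReal (tendsto_id.const_mul 2)
    simpa using this.mono_left nhdsWithin_le_nhds
  have hdiam : ∀ r : ℝ, 0 < r → ∀ x : X,
      Metric.ediam (Metric.ball x r) ≤ ENNReal.ofReal (2 * r) := by
    intro r hr x
    rw [← Metric.eball_ofReal, ENNReal.ofReal_mul (by norm_num)]
    simpa using Metric.ediam_eball_le (x := x) (r := ENNReal.ofReal r)
  refine le_antisymm (le_trans (Measure.hausdorffMeasure_le_liminf_tsum t E (l := 𝓝[>] (0 : ℝ))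
    (fun r : ℝ => ENNReal.ofReal (2 * r)) hlim
    (fun (r : ℝ) (x : s r) => Metric.ball (x : X) r) ?_ ?_) ?_) zero_le
  · filter_upwards [self_mem_nhdsWithin] with r hr x using hdiam r hr x
  · filter_upwards [self_mem_nhdsWithin] with r hr
    rw [Set.iUnion_subtype (fun x => x ∈ s r) fun x => Metric.ball (x : X) r]
    exact (hs r hr).2.2
  · rw [← h]
    refine liminf_le_liminf ?_
    filter_upwards [self_mem_nhdsWithin] with r hr
    obtain ⟨h1, h2, -⟩ := hs r hr
    calc ∑' x : s r, Metric.ediam (Metric.ball (x : X) r) ^ t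
        ≤ ∑' x : s r, 1 * ENNReal.ofReal (2 * r) ^ t := by
          refine ENNReal.tsum_le_tsum fun x => ?_
          rw [one_mul]
          exact ENNReal.rpow_le_rpow (hdiam r hr x) ht
      _ = (∑' x : s r, 1) * ENNReal.ofReal (2 * r) ^ t := ENNReal.tsum_mul_right
      _ ≤ _ := mul_le_mul_left (le_packingSum (fun _ => 1) h1 h2) _

end General

/-! ### Balls of the tree boundary as cylinders -/

namespace Boundary

/-- The set of words which agree with `x` on the first `n` letters. -/
def pre (x : Boundary) (n : ℕ) : Set Boundary := cylinder fun j : Fin n => x.letter j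

lemma mem_pre {x y : Boundary} {n : ℕ} : y ∈ pre x n ↔ ∀ j < n, y.letter j = x.letter j := by
  rw [pre, mem_cylinder, Fin.forall_iff]

lemma dist_def {x y : Boundary} (h : x ≠ y) : dist x y = (1 / 4 : ℝ) ^ commonLength x y :=
  if_neg h

lemma le_commonLength_iff {x y : Boundary} (h : x ≠ y) (n : ℕ) :
    n ≤ commonLength x y ↔ x ∈ pre y n := by
  rw [commonLength, ← PiNat.mem_cylinder_iff_le_firstDiff fun h' => h (Boundary.ext h'), mem_pre]
  exact Iff.rfl

lemma dist_le_of_mem_pre {x y : Boundary} {n : ℕ} (h : x ∈ pre y n) :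
    dist x y ≤ (1 / 4 : ℝ) ^ n := by
  by_cases hxy : x = y
  · rw [hxy, dist_self]
    positivity
  · rw [dist_def hxy]
    exact pow_le_pow_of_le_one (by norm_num) (by norm_num) ((le_commonLength_iff hxy n).2 h)

instance : IsUltrametricDist Boundary where
  dist_triangle_max x y z := by
    by_cases hxy : x = y
    · simp [hxy]
    by_cases hyz : y = z
    · simp [hyz]
    rw [dist_def hxy, dist_def hyz]
    have key : ∀ n, n ≤ commonLength x y → n ≤ commonLength y z → dist x z ≤ (1 / 4 : ℝ) ^ n := by
      intro n h1 h2
      rw [le_commonLength_iff hxy, mem_pre] at h1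
      rw [le_commonLength_iff hyz, mem_pre] at h2
      exact dist_le_of_mem_pre (mem_pre.2 fun j hj => (h1 j hj).trans (h2 j hj))
    rcases le_total (commonLength x y) (commonLength y z) with h | h
    · exact le_max_of_le_left (key _ le_rfl h)
    · exact le_max_of_le_right (key _ h le_rfl)

instance : SecondCountableTopology Boundary := by
  refine Metric.secondCountable_of_almost_dense_set fun ε hε => ?_
  obtain ⟨n, hn⟩ := exists_pow_lt_of_lt_one hε (by norm_num : (1 / 4 : ℝ) < 1)
  refine ⟨Set.range fun w : Fin n → Fin 4 => ⟨fun j => if h : j < n then w ⟨j, h⟩ else 0⟩,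
    Set.countable_range _, fun x => ⟨_, ⟨fun j => x.letter j, rfl⟩, ?_⟩⟩
  refine (dist_le_of_mem_pre (mem_pre.2 fun j hj => ?_)).trans hn.le
  simp [hj]

/-- The balls of radius `r ∈ (0, 1]` are the cylinders of length `level r`. -/
noncomputable def level (r : ℝ) : ℕ := ⌊-Real.logb 4 r⌋₊ + 1

lemma logb_le_of_level {r : ℝ} (h0 : 0 < r) (h1 : r ≤ 1) :
    Real.logb 4 r ≤ 1 - level r := by
  have := Nat.floor_le (neg_nonneg.2 (Real.logb_nonpos (b := 4) (by norm_num) h0.le h1))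
  rw [level]
  push_cast
  linarith

lemma lt_logb_of_level (r : ℝ) : -(level r : ℝ) < Real.logb 4 r := by
  have := Nat.lt_floor_add_one (-Real.logb 4 r)
  rw [level]
  push_cast
  linarith

/-- The ball is open: 4^(-k) < r means k > -log_4 r, that is k ≥ ⌊-log_4 r⌋ + 1. -/
lemma ball_eq_pre {r : ℝ} (h0 : 0 < r) (h1 : r ≤ 1) (x : Boundary) :
    Metric.ball x r = pre x (level r) := by
  ext y
  rw [Metric.mem_ball]
  constructor
  · intro h
    by_cases hxy : y = x
    · rw [hxy]
      exact mem_pre.2 fun _ _ => rfl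
    rw [← le_commonLength_iff hxy, level, Nat.succ_le_iff, Nat.floor_lt
      (neg_nonneg.2 (Real.logb_nonpos (b := 4) (by norm_num) h0.le h1))]
    rw [dist_def hxy] at h
    have := Real.logb_lt_logb (b := 4) (by norm_num) (by positivity) h
    rw [one_div, inv_pow, Real.logb_inv, Real.logb_pow, Real.logb_self_eq_one (by norm_num)] at this
    linarith
  · intro h
    refine (dist_le_of_mem_pre h).trans_lt ?_
    rw [← Real.logb_lt_logb_iff (b := 4) (by norm_num) (by positivity) h0, one_div, inv_pow,
      Real.logb_inv, Real.logb_pow, Real.logb_self_eq_one (by norm_num), mul_one]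
    exact lt_logb_of_level r

lemma level_pow (m : ℕ) : level ((1 / 4 : ℝ) ^ m) = m + 1 := by
  rw [level, one_div, inv_pow, Real.logb_inv, Real.logb_pow, Real.logb_self_eq_one (by norm_num)]
  simp

lemma tendsto_level : Tendsto level (𝓝[>] 0) atTop := by
  have h : Tendsto (fun r : ℝ => -Real.logb 4 r) (𝓝[>] 0) atTop :=
    tendsto_neg_atBot_atTop.comp (Real.tendsto_logb_nhdsGT_zero (by norm_num))
  exact tendsto_atTop_mono (fun r => Nat.le_succ _) (tendsto_nat_floor_atTop.comp h)

lemma tendsto_pow_nhdsGT : Tendsto (fun m : ℕ => (1 / 4 : ℝ) ^ m) atTop (𝓝[>] 0) :=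
  tendsto_pow_atTop_nhdsWithin_zero_of_lt_one (by norm_num) (by norm_num)

/-- Since log_4 2 = 1/2, the number log_4 (2r) + `level r` lies in (1/2, 3/2]; the error 2|s| covers
both signs of s. -/
lemma ofReal_two_mul_rpow {r : ℝ} (h0 : 0 < r) (h1 : r ≤ 1) (s : ℝ) :
    (4 : ℝ≥0∞) ^ (-(level r * s) - 2 * |s|) ≤ ENNReal.ofReal (2 * r) ^ s ∧
      ENNReal.ofReal (2 * r) ^ s ≤ (4 : ℝ≥0∞) ^ (-(level r * s) + 2 * |s|) := by
  have h2 : ENNReal.ofReal (2 * r) = (4 : ℝ≥0∞) ^ (1 / 2 + Real.logb 4 r) := by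
    have h4 : Real.logb 4 2 = 1 / 2 := by
      rw [Real.logb_eq_iff_rpow_eq (by norm_num) (by norm_num) (by norm_num),
        ← Real.sqrt_eq_rpow, show (4 : ℝ) = 2 ^ 2 by norm_num, Real.sqrt_sq (by norm_num)]
    rw [← h4, ← Real.logb_mul (by norm_num) h0.ne', show (4 : ℝ≥0∞) = ENNReal.ofReal 4 by simp,
      ENNReal.ofReal_rpow_of_pos (by norm_num), Real.rpow_logb (by norm_num) (by norm_num)
        (by positivity)]
  rw [h2, ← ENNReal.rpow_mul]
  have hb : |(1 / 2 + Real.logb 4 r + level r) * s| ≤ 2 * |s| := by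
    rw [abs_mul]
    gcongr
    have := logb_le_of_level h0 h1
    have := lt_logb_of_level r
    rw [abs_le]
    constructor <;> linarith
  rw [abs_le] at hb
  constructor <;> refine ENNReal.rpow_le_rpow_of_exponent_le (by norm_num) ?_ <;> nlinarith

end Boundary

lemma four_rpow_eq_ofReal (x : ℝ) : (4 : ℝ≥0∞) ^ x = ENNReal.ofReal ((4 : ℝ) ^ x) := by
  rw [← ENNReal.ofReal_rpow_of_pos (by norm_num)]
  simp

lemma four_rpow_add (x y : ℝ) : (4 : ℝ≥0∞) ^ (x + y) = 4 ^ x * 4 ^ y :=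
  ENNReal.rpow_add x y (by norm_num) (by norm_num)

lemma four_rpow_mono {x y : ℝ} (h : x ≤ y) : (4 : ℝ≥0∞) ^ x ≤ 4 ^ y :=
  ENNReal.rpow_le_rpow_of_exponent_le (by norm_num) h

lemma tendsto_four_rpow_zero {ι : Type*} {l : Filter ι} {x : ι → ℝ} (h : Tendsto x l atBot) :
    Tendsto (fun i => (4 : ℝ≥0∞) ^ x i) l (𝓝 0) := by
  simp_rw [four_rpow_eq_ofReal]
  have := (tendsto_rpow_atBot_of_base_gt_one 4 (by norm_num)).comp h
  simpa using ENNReal.tendsto_ofReal this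

lemma tendsto_four_rpow_top {ι : Type*} {l : Filter ι} {x : ι → ℝ} (h : Tendsto x l atTop) :
    Tendsto (fun i => (4 : ℝ≥0∞) ^ x i) l (𝓝 ∞) := by
  simp_rw [four_rpow_eq_ofReal]
  exact ENNReal.tendsto_ofReal_atTop.comp
    ((tendsto_rpow_atTop_of_base_gt_one 4 (by norm_num)).comp h)

namespace Boundary

/-- For n ≥ 1 the ball of this radius is exactly a cylinder of length n; the exponent is shifted
because balls are open. -/
lemma tendsto_radius : Tendsto (fun n : ℕ => (1 / 4 : ℝ) ^ (n - 1)) atTop (𝓝[>] 0) :=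
  tendsto_pow_nhdsGT.comp (tendsto_sub_atTop_nat 1)

lemma level_radius {n : ℕ} (hn : 1 ≤ n) : level ((1 / 4 : ℝ) ^ (n - 1)) = n := by
  rw [level_pow]
  omega

/-! ### Values of the pre-measures from estimates on cylinders -/

section Criteria

variable {ν : Measure Boundary} {c : Set Boundary → ℝ≥0∞} {s : ℕ → ℝ} {F : Set Boundary} {t : ℝ}

lemma packingSum_mul_le
    (h : ∀ᶠ n in atTop, ∀ x ∈ F, c (pre x n) ≤ 4 ^ s n * ν (pre x n)) :
    ∀ᶠ r in 𝓝[>] (0 : ℝ), packingSum c r F * ENNReal.ofReal (2 * r) ^ t ≤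
      4 ^ (s (level r) - level r * t + 2 * |t|) * ν Set.univ := by
  filter_upwards [tendsto_level.eventually h, Ioc_mem_nhdsGT one_pos] with r hr h01
  calc packingSum c r F * ENNReal.ofReal (2 * r) ^ t
      ≤ (4 ^ s (level r) * ν Set.univ) * 4 ^ (-(level r * t) + 2 * |t|) := by
        gcongr
        · refine packingSum_le_mul_measure ν fun x hx => ?_
          rw [ball_eq_pre h01.1 h01.2]
          exact hr x hx
        · exact (ofReal_two_mul_rpow h01.1 h01.2 t).2
    _ = _ := by
        rw [mul_right_comm, ← four_rpow_add]
        congr 2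
        ring

lemma le_coveringSum_mul
    (h : ∀ᶠ n in atTop, ∀ x ∈ F, 4 ^ s n * ν (pre x n) ≤ c (pre x n)) :
    ∀ᶠ r in 𝓝[>] (0 : ℝ), 4 ^ (s (level r) - level r * t - 2 * |t|) * ν F ≤
      coveringSum c r F * ENNReal.ofReal (2 * r) ^ t := by
  filter_upwards [tendsto_level.eventually h, Ioc_mem_nhdsGT one_pos] with r hr h01
  calc 4 ^ (s (level r) - level r * t - 2 * |t|) * ν F
      = (4 ^ s (level r) * ν F) * 4 ^ (-(level r * t) - 2 * |t|) := by
        rw [mul_right_comm, ← four_rpow_add]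
        congr 2
        ring
    _ ≤ _ := by
        gcongr
        · refine mul_measure_le_coveringSum ν fun x hx => ?_
          rw [ball_eq_pre h01.1 h01.2]
          exact hr x hx
        · exact (ofReal_two_mul_rpow h01.1 h01.2 t).1

lemma liminf_le_liminf_radius (u : ℝ → ℝ≥0∞) {φ : ℕ → ℕ} (hφ : Tendsto φ atTop atTop) :
    liminf u (𝓝[>] 0) ≤ liminf (fun k => u ((1 / 4 : ℝ) ^ (φ k - 1))) atTop :=
  liminf_le_liminf_of_le (u := u) (tendsto_radius.comp hφ)

lemma limsup_radius_le_limsup (u : ℝ → ℝ≥0∞) {φ : ℕ → ℕ} (hφ : Tendsto φ atTop atTop) :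
    limsup (fun k => u ((1 / 4 : ℝ) ^ (φ k - 1))) atTop ≤ limsup u (𝓝[>] 0) :=
  limsup_le_limsup_of_le (u := u) (tendsto_radius.comp hφ)

lemma tendsto_bound_zero [IsFiniteMeasure ν] {ι : Type*} {l : Filter ι} {x : ι → ℝ}
    (h : Tendsto x l atBot) (C : ℝ) :
    Tendsto (fun i => (4 : ℝ≥0∞) ^ (x i + C) * ν Set.univ) l (𝓝 0) := by
  simpa using ENNReal.Tendsto.mul_const
    (tendsto_four_rpow_zero (tendsto_atBot_add_const_right l C h))
    (Or.inr (measure_ne_top ν Set.univ))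

lemma tendsto_bound_top (hF : ν F ≠ 0) {ι : Type*} {l : Filter ι} {x : ι → ℝ}
    (h : Tendsto x l atTop) (C : ℝ) :
    Tendsto (fun i => (4 : ℝ≥0∞) ^ (x i - C) * ν F) l (𝓝 ∞) := by
  simp_rw [sub_eq_add_neg]
  simpa [ENNReal.top_mul hF] using ENNReal.Tendsto.mul_const (b := ν F)
    (tendsto_four_rpow_top (tendsto_atTop_add_const_right l (-C) h)) (Or.inl ENNReal.top_ne_zero)

lemma upperPre_eq_zero [IsFiniteMeasure ν]
    (h : ∀ᶠ n in atTop, ∀ x ∈ F, c (pre x n) ≤ 4 ^ s n * ν (pre x n))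
    (hs : Tendsto (fun n => s n - n * t) atTop atBot) : upperPre c t F = 0 :=
  (tendsto_of_tendsto_of_tendsto_of_le_of_le' tendsto_const_nhds
    (tendsto_bound_zero (ν := ν) (hs.comp tendsto_level) (2 * |t|))
    (Eventually.of_forall fun _ => zero_le) (packingSum_mul_le h)).limsup_eq

lemma liminf_packingSum_eq_zero [IsFiniteMeasure ν] {φ : ℕ → ℕ} (hφ : Tendsto φ atTop atTop)
    (h : ∀ᶠ n in atTop, ∀ x ∈ F, c (pre x n) ≤ 4 ^ s n * ν (pre x n))
    (hs : Tendsto (fun k => s (φ k) - φ k * t) atTop atBot) :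
    liminf (fun r : ℝ => packingSum c r F * ENNReal.ofReal (2 * r) ^ t) (𝓝[>] 0) = 0 := by
  refine le_antisymm ((liminf_le_liminf_radius _ hφ).trans (le_of_eq ?_)) zero_le
  refine (tendsto_of_tendsto_of_tendsto_of_le_of_le' tendsto_const_nhds
    (tendsto_bound_zero (ν := ν) hs (2 * |t|)) (Eventually.of_forall fun _ => zero_le) ?_).liminf_eq
  filter_upwards [(tendsto_radius.comp hφ).eventually (packingSum_mul_le (t := t) h),
    hφ.eventually (eventually_ge_atTop 1)] with k hk hk1
  simpa only [Function.comp, level_radius hk1] using hk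

lemma lowerL_eq_top (hF : ν F ≠ 0)
    (h : ∀ᶠ n in atTop, ∀ x ∈ F, 4 ^ s n * ν (pre x n) ≤ c (pre x n))
    (hs : Tendsto (fun n => s n - n * t) atTop atTop) : lowerL c t F = ∞ :=
  (tendsto_of_tendsto_of_tendsto_of_le_of_le'
    (tendsto_bound_top (ν := ν) hF (hs.comp tendsto_level) (2 * |t|)) tendsto_const_nhds
    (le_coveringSum_mul h) (Eventually.of_forall fun _ => le_top)).liminf_eq

/-- A limsup only needs the subsequence of lengths `φ k`; the lower bound for the covering sum
passes to the packing sum because the space is ultrametric. -/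
lemma upperPre_eq_top (hF : ν F ≠ 0) {φ : ℕ → ℕ} (hφ : Tendsto φ atTop atTop)
    (h : ∀ᶠ n in atTop, ∀ x ∈ F, 4 ^ s n * ν (pre x n) ≤ c (pre x n))
    (hs : Tendsto (fun k => s (φ k) - φ k * t) atTop atTop) : upperPre c t F = ∞ := by
  refine top_le_iff.1 (le_trans (le_of_eq ?_) (limsup_radius_le_limsup _ hφ))
  refine (tendsto_of_tendsto_of_tendsto_of_le_of_le'
    (tendsto_bound_top (ν := ν) hF hs (2 * |t|)) tendsto_const_nhds
    ?_ (Eventually.of_forall fun _ => le_top)).limsup_eq.symm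
  have hr := tendsto_radius.comp hφ
  filter_upwards [hr.eventually (le_coveringSum_mul (t := t) h),
    hr.eventually self_mem_nhdsWithin,
    hφ.eventually (eventually_ge_atTop 1)] with k hk hk0 hk1
  simp only [Function.comp, level_radius hk1] at hk
  exact hk.trans (mul_le_mul_left (coveringSum_le_packingSum c hk0 F) _)

/-- Once δ is small, each ball of a δ-packing contributes at most ε times its own ν-mass, whatever
its radius, and disjoint masses add up to at most 1. -/
lemma packingPre_eq_zero [IsProbabilityMeasure ν]
    (h : ∀ᶠ n in atTop, ∀ x ∈ F, 1 ≤ 4 ^ s n * ν (pre x n))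
    (hs : Tendsto (fun n => s n - n * t) atTop atBot) : packingPre t F = 0 := by
  refine le_antisymm (ENNReal.le_of_forall_pos_le_add fun ε hε _ => ?_) zero_le
  rw [zero_add]
  have hlim := tendsto_four_rpow_zero
    (tendsto_atBot_add_const_right _ (2 * |t|) (hs.comp tendsto_level))
  have hev := ((hlim.eventually (gt_mem_nhds (ENNReal.coe_pos.2 hε))).and
    (tendsto_level.eventually h)).and (Ioc_mem_nhdsGT one_pos)
  obtain ⟨δ, hδ, hsub⟩ := (mem_nhdsGT_iff_exists_Ioc_subset).1 hev
  refine iInf_le_of_le δ (iInf_le_of_le hδ (iSup_le fun S => iSup_le fun hS => ?_))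
  calc ∑' p : S, ENNReal.ofReal (2 * p.1.2) ^ t
      ≤ ∑' p : S, ε * ν (Metric.ball p.1.1 p.1.2) := by
        refine ENNReal.tsum_le_tsum fun p => ?_
        obtain ⟨hp1, hp2, hp3⟩ := hS.1 p.1 p.2
        obtain ⟨⟨h1, h2⟩, h3⟩ := hsub (Set.mem_Ioc.2 ⟨hp2, hp3⟩)
        rw [ball_eq_pre h3.1 h3.2]
        set n := level p.1.2
        calc ENNReal.ofReal (2 * p.1.2) ^ t
            ≤ 4 ^ (-(n * t) + 2 * |t|) * 1 := by
              rw [mul_one]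
              exact (ofReal_two_mul_rpow h3.1 h3.2 t).2
          _ ≤ 4 ^ (-(n * t) + 2 * |t|) * (4 ^ s n * ν (pre p.1.1 n)) := by
              gcongr
              exact h2 _ hp1
          _ = 4 ^ (s n - n * t + 2 * |t|) * ν (pre p.1.1 n) := by
              rw [← mul_assoc, ← four_rpow_add]
              congr 2
              ring
          _ ≤ ε * ν (pre p.1.1 n) := by
              gcongr
              exact h1.le
    _ = ε * ∑' p : S, ν (Metric.ball p.1.1 p.1.2) := ENNReal.tsum_mul_left
    _ ≤ ε * ν Set.univ := by
        gcongr
        refine (tsum_meas_le_meas_iUnion_of_disjoint ν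
          (As := fun p : S => Metric.ball p.1.1 p.1.2) (fun _ => measurableSet_ball) ?_).trans
          (measure_mono (Set.subset_univ _))
        exact fun p q hpq => hS.2 p.2 q.2 fun h => hpq (Subtype.ext h)
    _ = ε := by simp

/-- This is the mass distribution principle, applied to the outer measure S ↦ ν(S ∩ F) since `F`
need not be measurable. -/
lemma hausdorffMeasure_ne_zero (ht : 0 < t) (hF : ν F ≠ 0)
    (h : ∀ᶠ n : ℕ in atTop, ∀ x ∈ F, ν (pre x n) ≤ 4 ^ (-(n * t))) : μH[t] F ≠ 0 := by
  have hev := (tendsto_level.eventually h).and (Ioc_mem_nhdsGT one_pos)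
  obtain ⟨δ, hδ : 0 < δ, hsub⟩ := (mem_nhdsGT_iff_exists_Ioc_subset).1 hev
  -- The factor 2^t turns a diameter d into 2d; the factor 4^(2t) is the loss in
  -- `ofReal_two_mul_rpow`.
  set C : ℝ≥0∞ := 4 ^ (2 * t) * 2 ^ t
  have hC0 : C ≠ 0 := by simp [C]
  have hCt : C ≠ ∞ := by
    refine ENNReal.mul_ne_top ?_ ?_ <;>
      exact ENNReal.rpow_ne_top_of_nonneg (by positivity) (by norm_num)
  have key : C⁻¹ • OuterMeasure.restrict F ν.toOuterMeasure ≤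
      OuterMeasure.mkMetric fun d : ℝ≥0∞ => d ^ t := by
    refine OuterMeasure.le_mkMetric _ _ (ENNReal.ofReal (δ / 2)) (by simpa using hδ) fun S hS => ?_
    rw [_root_.smul_apply, OuterMeasure.restrict_apply, smul_eq_mul,
      ENNReal.inv_mul_le_iff hC0 hCt]
    change ν (S ∩ F) ≤ _
    rcases (S ∩ F).eq_empty_or_nonempty with he | ⟨x, hxS, hxF⟩
    · simp [he]
    have hfin : Metric.ediam S ≠ ∞ := ne_top_of_le_ne_top ENNReal.ofReal_ne_top hS
    set d := (Metric.ediam S).toReal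
    have hd : Metric.ediam S = ENNReal.ofReal d := (ENNReal.ofReal_toReal hfin).symm
    have hd0 : 0 ≤ d := ENNReal.toReal_nonneg
    have hdδ : d < δ := by
      rw [hd, ENNReal.ofReal_le_ofReal_iff (by positivity)] at hS
      linarith
    -- An open ball contains S only if its radius exceeds d, so the bound is proved for r > d and r
    -- decreases to d. This also handles d = 0.
    have hlim : Tendsto (fun r : ℝ => (4 : ℝ≥0∞) ^ (2 * t) * ENNReal.ofReal (2 * r) ^ t) (𝓝[>] d)
        (𝓝 (C * Metric.ediam S ^ t)) := by
      have h1 : C * Metric.ediam S ^ t = 4 ^ (2 * t) * ENNReal.ofReal (2 * d) ^ t := by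
        rw [hd, ENNReal.ofReal_mul (by norm_num), ENNReal.mul_rpow_of_nonneg _ _ ht.le, mul_assoc]
        simp
      rw [h1]
      refine ENNReal.Tendsto.const_mul ?_ (Or.inr
        (ENNReal.rpow_ne_top_of_nonneg (by positivity) (by norm_num)))
      exact ((ENNReal.tendsto_ofReal (tendsto_id.const_mul 2)).ennrpow_const t).mono_left
        nhdsWithin_le_nhds
    refine ge_of_tendsto hlim ?_
    filter_upwards [Ioc_mem_nhdsGT hdδ] with r hr
    have hr0 : 0 < r := hd0.trans_lt hr.1
    obtain ⟨h1, h2⟩ := hsub (Set.mem_Ioc.2 ⟨hr0, hr.2⟩)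
    calc ν (S ∩ F) ≤ ν (Metric.ball x r) := by
          refine measure_mono fun y hy => ?_
          have := Metric.edist_le_ediam_of_mem hy.1 hxS
          rw [hd, edist_dist, ENNReal.ofReal_le_ofReal_iff hd0] at this
          exact this.trans_lt hr.1
      _ ≤ 4 ^ (-(level r * t)) := by
          rw [ball_eq_pre h2.1 h2.2]
          exact h1 x hxF
      _ = 4 ^ (2 * t) * 4 ^ (-(level r * t) - 2 * t) := by
          rw [← four_rpow_add]
          congr 1
          ring
      _ ≤ _ := by
          gcongr
          simpa only [abs_of_pos ht] using (ofReal_two_mul_rpow h2.1 h2.2 t).1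
  intro h0
  have h1 := key F
  rw [← Measure.mkMetric_toOuterMeasure] at h1
  change _ ≤ μH[t] F at h1
  rw [h0, _root_.smul_apply, OuterMeasure.restrict_apply, Set.inter_self, smul_eq_mul,
    nonpos_iff_eq_zero, mul_eq_zero, ENNReal.inv_eq_zero] at h1
  exact h1.elim hCt hF

end Criteria

end Boundary

/-! ### Blocks and averages of block sums -/

open Classical in
/-- `u` at the positions of the blocks `[t (2k-1), t (2k))`, and `v` at the other ones. -/
noncomputable def blockVal {β : Type*} (t : ℕ → ℕ) (u v : β) (j : ℕ) : β :=
  if ∃ k : ℕ, 1 ≤ k ∧ t (2 * k - 1) ≤ j ∧ j < t (2 * k) then u else v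

lemma blockWeight_eq_blockVal (a b : Fin 4 → ℝ) (t : ℕ → ℕ) (j : ℕ) :
    blockWeight a b t j = blockVal t a b j := rfl

lemma blockVal_cases {β : Type*} (t : ℕ → ℕ) (u v : β) (j : ℕ) :
    blockVal t u v j = u ∨ blockVal t u v j = v := by
  unfold blockVal
  split <;> simp

/-- The sum of `blockVal t u v` over the positions `1, …, n`. -/
noncomputable def blockSum (t : ℕ → ℕ) (u v : ℝ) (n : ℕ) : ℝ :=
  ∑ j ∈ Finset.range n, blockVal t u v (j + 1)

lemma blockSum_le {t : ℕ → ℕ} {u v c : ℝ} (hu : u ≤ c) (hv : v ≤ c) (n : ℕ) :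
    blockSum t u v n ≤ n * c := by
  have := Finset.sum_le_card_nsmul (Finset.range n) (fun j => blockVal t u v (j + 1)) c
    fun j _ => by rcases blockVal_cases t u v (j + 1) with h | h <;> rw [h] <;> assumption
  simpa [blockSum] using this

lemma le_blockSum {t : ℕ → ℕ} {u v c : ℝ} (hu : c ≤ u) (hv : c ≤ v) (n : ℕ) :
    n * c ≤ blockSum t u v n := by
  have := Finset.card_nsmul_le_sum (Finset.range n) (fun j => blockVal t u v (j + 1)) c
    fun j _ => by rcases blockVal_cases t u v (j + 1) with h | h <;> rw [h] <;> assumption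
  simpa [blockSum] using this

section Blocks

variable {t : ℕ → ℕ}

lemma strictMono_shift (ht : ∀ k, 1 ≤ k → t k < t (k + 1)) : StrictMono fun k => t (k + 1) :=
  strictMono_nat_of_lt_succ fun k => ht (k + 1) (by omega)

lemma lt_of_block (ht : ∀ k, 1 ≤ k → t k < t (k + 1)) {i k : ℕ} (hk : 1 ≤ k) (h : t i < t k) (hi : 1 ≤ i) : i < k := by
  obtain ⟨i, rfl⟩ := Nat.exists_eq_add_of_le' hi
  obtain ⟨k, rfl⟩ := Nat.exists_eq_add_of_le' hk
  have := (strictMono_shift ht).lt_iff_lt.1 h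
  omega

lemma blockVal_of_mem {β : Type*} (ht : ∀ k, 1 ≤ k → t k < t (k + 1))
    (u v : β) {i j : ℕ} (hi : 1 ≤ i) (h1 : t i ≤ j)
    (h2 : j < t (i + 1)) : blockVal t u v j = if Odd i then u else v := by
  unfold blockVal
  congr 1
  refine propext ⟨?_, ?_⟩
  · rintro ⟨k, hk, h3, h4⟩
    have h5 := lt_of_block ht (by omega) (h3.trans_lt h2) (by omega)
    have h6 := lt_of_block ht (by omega) (h1.trans_lt h4) hi
    -- The two inequalities force i = 2k - 1.
    exact ⟨k - 1, by omega⟩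
  · rintro ⟨m, rfl⟩
    exact ⟨m + 1, by omega, h1, h2⟩

/-- Every position of block i contributes its exact value; only positions before `t i` can differ,
each by at most |u - v|. -/
lemma abs_blockSum_sub_le (ht : ∀ k, 1 ≤ k → t k < t (k + 1)) (u v : ℝ) {i : ℕ} (hi : 1 ≤ i) :
    |blockSum t u v (t (i + 1) - 1) - (t (i + 1) - 1 : ℕ) * (if Odd i then u else v)| ≤
      t i * |u - v| := by
  set w := if Odd i then u else v with hw
  have hlt := ht i hi
  have h1 : blockSum t u v (t (i + 1) - 1) - (t (i + 1) - 1 : ℕ) * w =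
      ∑ j ∈ Finset.range (t (i + 1) - 1), (blockVal t u v (j + 1) - w) := by
    rw [Finset.sum_sub_distrib, blockSum]
    simp
  have h2 : ∑ j ∈ Finset.range (t (i + 1) - 1), (blockVal t u v (j + 1) - w) =
      ∑ j ∈ Finset.range (t i - 1), (blockVal t u v (j + 1) - w) := by
    refine (Finset.sum_subset (Finset.range_mono (by omega)) fun j hj hj' => ?_).symm
    rw [Finset.mem_range] at hj hj'
    rw [blockVal_of_mem ht u v hi (by omega) (by omega), sub_self]
  rw [h1, h2]
  calc |∑ j ∈ Finset.range (t i - 1), (blockVal t u v (j + 1) - w)|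
      ≤ ∑ j ∈ Finset.range (t i - 1), |blockVal t u v (j + 1) - w| :=
        Finset.abs_sum_le_sum_abs _ _
    _ ≤ ∑ j ∈ Finset.range (t i - 1), |u - v| := by
        refine Finset.sum_le_sum fun j _ => ?_
        rcases blockVal_cases t u v (j + 1) with h | h <;> rw [h, hw] <;> split_ifs <;>
          simp [abs_sub_comm]
    _ ≤ t i * |u - v| := by
        rw [Finset.sum_const, Finset.card_range, nsmul_eq_mul]
        gcongr
        omega

lemma le_apply_shift (ht : ∀ k, 1 ≤ k → t k < t (k + 1)) (i : ℕ) : i ≤ t (i + 1) :=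
  (strictMono_shift ht).le_apply

lemma tendsto_blockSum (ht : ∀ k, 1 ≤ k → t k < t (k + 1))
    (htlim : Tendsto (fun k => (t (k + 1) : ℝ) / (t k : ℝ)) atTop atTop) (u v : ℝ) :
    Tendsto (fun i => blockSum t u v (t (i + 1) - 1) / (t (i + 1) - 1 : ℕ) -
      (if Odd i then u else v)) atTop (𝓝 0) := by
  have h1 : Tendsto (fun i => 2 * |u - v| * ((t (i + 1) : ℝ) / (t i : ℝ))⁻¹) atTop (𝓝 0) := by
    simpa using htlim.inv_tendsto_atTop.const_mul (2 * |u - v|)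
  refine squeeze_zero_norm' ?_ h1
  filter_upwards [eventually_ge_atTop 2] with i hi
  have hlt := le_apply_shift ht i
  obtain ⟨N, hN⟩ : ∃ N, t (i + 1) = N + 1 := ⟨t (i + 1) - 1, by omega⟩
  have key := abs_blockSum_sub_le ht u v (i := i) (by omega)
  have hN0 : 1 ≤ N := by omega
  rw [hN, Nat.add_sub_cancel] at *
  have hN1 : (0 : ℝ) < N := by exact_mod_cast hN0
  rw [Real.norm_eq_abs, div_sub' hN1.ne', abs_div, abs_of_pos hN1, div_le_iff₀ hN1, inv_div]
  refine key.trans ?_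
  -- The average divides by N = t_{i+1} - 1 but the hypothesis concerns t_{i+1}; the factor 2 in
  -- `h1` absorbs the shift.
  have h3 : (1 : ℝ) ≤ 2 * N / (N + 1 : ℕ) := by
    rw [le_div_iff₀ (by positivity)]
    push_cast
    have : (1 : ℝ) ≤ N := by exact_mod_cast hN0
    linarith
  calc (t i : ℝ) * |u - v| = t i * |u - v| * 1 := by ring
    _ ≤ t i * |u - v| * (2 * N / (N + 1 : ℕ)) := by gcongr
    _ = _ := by ring

/-- The last positions of the blocks in which `blockVal t u v` is `u`. -/
def firstEnd (t : ℕ → ℕ) (k : ℕ) : ℕ := t (2 * k + 1 + 1) - 1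

/-- The last positions of the blocks in which `blockVal t u v` is `v`. -/
def secondEnd (t : ℕ → ℕ) (k : ℕ) : ℕ := t (2 * k + 1) - 1

lemma tendsto_firstEnd (ht : ∀ k, 1 ≤ k → t k < t (k + 1)) :
    Tendsto (firstEnd t) atTop atTop :=
  tendsto_atTop_mono (f := fun k => k) (fun k => by
    have := le_apply_shift ht (2 * k + 1)
    unfold firstEnd
    omega) tendsto_id

lemma tendsto_secondEnd (ht : ∀ k, 1 ≤ k → t k < t (k + 1)) :
    Tendsto (secondEnd t) atTop atTop :=
  tendsto_atTop_mono (f := fun k => k - 1) (fun k => by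
    have := le_apply_shift ht (2 * k)
    unfold secondEnd
    omega) (tendsto_sub_atTop_nat 1)

lemma tendsto_blockSum_firstEnd (ht : ∀ k, 1 ≤ k → t k < t (k + 1))
    (htlim : Tendsto (fun k => (t (k + 1) : ℝ) / (t k : ℝ)) atTop atTop) (u v : ℝ) :
    Tendsto (fun k => blockSum t u v (firstEnd t k) / firstEnd t k) atTop (𝓝 u) := by
  have h1 : Tendsto (fun k : ℕ => 2 * k + 1) atTop atTop :=
    tendsto_atTop_mono (f := fun k => k) (fun k => by omega) tendsto_id
  have h2 := ((tendsto_blockSum ht htlim u v).comp h1).add_const u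
  rw [zero_add] at h2
  refine h2.congr fun k => ?_
  have : Odd (2 * k + 1) := ⟨k, rfl⟩
  simp [this, firstEnd]

lemma tendsto_blockSum_secondEnd (ht : ∀ k, 1 ≤ k → t k < t (k + 1))
    (htlim : Tendsto (fun k => (t (k + 1) : ℝ) / (t k : ℝ)) atTop atTop) (u v : ℝ) :
    Tendsto (fun k => blockSum t u v (secondEnd t k) / secondEnd t k) atTop (𝓝 v) := by
  have h1 : Tendsto (fun k : ℕ => 2 * k) atTop atTop :=
    tendsto_atTop_mono (f := fun k => k) (fun k => by omega) tendsto_id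
  have h2 := ((tendsto_blockSum ht htlim u v).comp h1).add_const v
  rw [zero_add] at h2
  refine h2.congr fun k => ?_
  have : ¬Odd (2 * k) := by
    rintro ⟨m, hm⟩
    omega
  simp [this, secondEnd]

end Blocks

/-! ### Cylinder masses and Gibbs weights -/

section Weights

variable {a b p : Fin 4 → ℝ} {t : ℕ → ℕ}

/-- `-log₄ p₁ ⋯ pₙ`, where `p₁ ⋯ pₙ` is the product of the weights along `x`. -/
noncomputable def cost (a b : Fin 4 → ℝ) (t : ℕ → ℕ) (n : ℕ) (x : Boundary) : ℝ :=
  ∑ j ∈ Finset.range n, -Real.logb 4 (blockWeight a b t (j + 1) (x.letter j))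

lemma isProbabilityMeasure_blockWeight (ha : ∀ i, 0 ≤ a i) (hb : ∀ i, 0 ≤ b i)
    (ha1 : ∑ i, a i = 1) (hb1 : ∑ i, b i = 1) (t : ℕ → ℕ) (j : ℕ) :
    IsProbabilityMeasure (letterMeasure (blockWeight a b t j)) := by
  rcases blockVal_cases t a b j with h | h <;> rw [blockWeight_eq_blockVal, h]
  · exact isProbabilityMeasure_letterMeasure ha ha1
  · exact isProbabilityMeasure_letterMeasure hb hb1

lemma isProbabilityMeasure_blockMeasure (ha : ∀ i, 0 ≤ a i) (hb : ∀ i, 0 ≤ b i)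
    (ha1 : ∑ i, a i = 1) (hb1 : ∑ i, b i = 1) (t : ℕ → ℕ) :
    IsProbabilityMeasure (blockMeasure a b t) := by
  have := isProbabilityMeasure_blockWeight ha hb ha1 hb1 t
  exact Measure.isProbabilityMeasure_map Boundary.measurable_mk.aemeasurable

lemma blockMeasure_pre (ha : ∀ i, 0 < a i) (hb : ∀ i, 0 < b i)
    (ha1 : ∑ i, a i = 1) (hb1 : ∑ i, b i = 1) (t : ℕ → ℕ) (x : Boundary) (n : ℕ) :
    blockMeasure a b t (x.pre n) = (4 : ℝ≥0∞) ^ (-cost a b t n x) := by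
  have hpos : ∀ j i, 0 < blockWeight a b t j i := fun j i => by
    rcases blockVal_cases t a b j with h | h <;> rw [blockWeight_eq_blockVal, h]
    exacts [ha i, hb i]
  rw [Boundary.pre, blockMeasure_cylinder (fun i => (ha i).le) (fun i => (hb i).le) ha1 hb1,
    Fin.prod_univ_eq_prod_range
      (fun j => ENNReal.ofReal (blockWeight a b t (j + 1) (x.letter j))) n,
    ← ENNReal.ofReal_prod_of_nonneg fun j _ => (hpos _ _).le, four_rpow_eq_ofReal, cost,
    Finset.sum_neg_distrib, neg_neg, Real.rpow_sum_of_pos (by norm_num)]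
  congr 1
  exact Finset.prod_congr rfl fun j _ =>
    (Real.rpow_logb (by norm_num) (by norm_num) (hpos _ _)).symm

/-- `log₄ (p₁ ^ q + ⋯ + p₄ ^ q)`. -/
noncomputable def pressure (p : Fin 4 → ℝ) (q : ℝ) : ℝ := Real.logb 4 (∑ i, p i ^ q)

/-- The normalised weights `pᵢ ^ q`. -/
noncomputable def gibbs (p : Fin 4 → ℝ) (q : ℝ) (i : Fin 4) : ℝ := p i ^ q / ∑ i, p i ^ q

lemma sum_rpow_pos (hp : ∀ i, 0 < p i) (q : ℝ) : 0 < ∑ i, p i ^ q :=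
  Finset.sum_pos (fun i _ => Real.rpow_pos_of_pos (hp i) q) Finset.univ_nonempty

lemma gibbs_pos (hp : ∀ i, 0 < p i) (q : ℝ) (i : Fin 4) : 0 < gibbs p q i :=
  div_pos (Real.rpow_pos_of_pos (hp i) q) (sum_rpow_pos hp q)

lemma sum_gibbs (hp : ∀ i, 0 < p i) (q : ℝ) : ∑ i, gibbs p q i = 1 := by
  simp only [gibbs]
  rw [← Finset.sum_div, div_self (sum_rpow_pos hp q).ne']

lemma neg_logb_gibbs (hp : ∀ i, 0 < p i) (q : ℝ) (i : Fin 4) :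
    -Real.logb 4 (gibbs p q i) = q * -Real.logb 4 (p i) + pressure p q := by
  rw [gibbs, pressure, Real.logb_div (Real.rpow_pos_of_pos (hp i) q).ne' (sum_rpow_pos hp q).ne',
    Real.logb_rpow_eq_mul_logb_of_pos (hp i)]
  ring

/-- Raising weights to the power q multiplies the cost by q, and each normalisation adds one
pressure per letter. -/
lemma cost_gibbs (ha : ∀ i, 0 < a i) (hb : ∀ i, 0 < b i) (q : ℝ) (n : ℕ) (x : Boundary) :
    cost (gibbs a q) (gibbs b q) t n x =
      q * cost a b t n x + blockSum t (pressure a q) (pressure b q) n := by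
  rw [cost, cost, blockSum, Finset.mul_sum, ← Finset.sum_add_distrib]
  refine Finset.sum_congr rfl fun j _ => ?_
  simp only [blockWeight_eq_blockVal, blockVal]
  split_ifs
  · exact neg_logb_gibbs ha q _
  · exact neg_logb_gibbs hb q _

end Weights

/-! ### A strong law for independent letters with varying distribution -/

open ProbabilityTheory in
/-- The strong law of large numbers for uniformly bounded centred independent variables. -/
lemma ae_tendsto_average_of_iIndepFun {Ω : Type*} [MeasurableSpace Ω] {μ : Measure Ω}
    [IsProbabilityMeasure μ] {X : ℕ → Ω → ℝ} (hX : ∀ i, Measurable (X i)) (hind : iIndepFun X μ)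
    {C : ℝ} (hC : ∀ i ω, |X i ω| ≤ C) (h0 : ∀ i, ∫ ω, X i ω ∂μ = 0) :
    ∀ᵐ ω ∂μ, Tendsto (fun n : ℕ => (∑ i ∈ Finset.range n, X i ω) / n) atTop (𝓝 0) := by
  -- One-sided bound by Hoeffding and Borel–Cantelli, used for X and for -X. Identical distribution
  -- is not available, as the weights change between blocks.
  have key : ∀ Y : ℕ → Ω → ℝ, (∀ i, Measurable (Y i)) → iIndepFun Y μ →
      (∀ i ω, |Y i ω| ≤ C) → (∀ i, ∫ ω, Y i ω ∂μ = 0) → ∀ ε : ℝ, 0 < ε →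
      ∀ᵐ ω ∂μ, ∀ᶠ n : ℕ in atTop, ∑ i ∈ Finset.range n, Y i ω < ε * n := by
    intro Y hY hi hb hz ε hε
    -- Enlarging the bound makes D positive, hence also the sub-Gaussian parameter by which one
    -- divides.
    set D := |C| + 1
    have hD : 0 < D := by positivity
    set c : ℝ≥0 := (‖D - -D‖₊ / 2) ^ 2
    have hc : (0 : ℝ) < c := by
      have : D - -D ≠ 0 := by linarith
      have := nnnorm_pos.2 this
      positivity
    have hsub : ∀ i, HasSubgaussianMGF (Y i) c μ := fun i =>
      hasSubgaussianMGF_of_mem_Icc_of_integral_eq_zero (hY i).aemeasurable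
        (Eventually.of_forall fun ω => abs_le.1 ((hb i ω).trans
          ((le_abs_self C).trans (lt_add_one _).le))) (hz i)
    have hle : ∀ n : ℕ, μ {ω | ε * n ≤ ∑ i ∈ Finset.range n, Y i ω} ≤
        ENNReal.ofReal (Real.exp (-(ε ^ 2 / (2 * c))) ^ n) := by
      intro n
      rw [← ofReal_measureReal]
      refine ENNReal.ofReal_le_ofReal ?_
      refine (HasSubgaussianMGF.measure_sum_range_ge_le_of_iIndepFun hi
        (fun i _ => hsub i) (by positivity)).trans ?_
      rw [← Real.exp_nat_mul]
      refine Real.exp_le_exp.2 (le_of_eq ?_)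
      rcases Nat.eq_zero_or_pos n with rfl | hn
      · simp
      · have : (0 : ℝ) < n := by exact_mod_cast hn
        field_simp
    have hsum : ∑' n : ℕ, μ {ω | ε * n ≤ ∑ i ∈ Finset.range n, Y i ω} ≠ ∞ := by
      refine ne_top_of_le_ne_top ?_ (ENNReal.tsum_le_tsum hle)
      refine Summable.tsum_ofReal_ne_top ?_
      exact summable_geometric_of_lt_one (Real.exp_nonneg _) (Real.exp_lt_one_iff.2 (by
        have : 0 < ε ^ 2 / (2 * c) := by positivity
        linarith))
    filter_upwards [ae_eventually_notMem hsum] with ω hω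
    filter_upwards [hω] with n hn
    simpa using hn
  have hpos : ∀ᵐ ω ∂μ, ∀ k : ℕ, ∀ᶠ n : ℕ in atTop,
      ∑ i ∈ Finset.range n, X i ω < (1 / (k + 1) : ℝ) * n :=
    ae_all_iff.2 fun k => key X hX hind hC h0 _ (by positivity)
  have hneg : ∀ᵐ ω ∂μ, ∀ k : ℕ, ∀ᶠ n : ℕ in atTop,
      ∑ i ∈ Finset.range n, -X i ω < (1 / (k + 1) : ℝ) * n :=
    ae_all_iff.2 fun k => key (fun i ω => -X i ω) (fun i => (hX i).neg)
      (hind.comp (fun _ x => -x) fun _ => measurable_neg)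
      (fun i ω => by rw [abs_neg]; exact hC i ω)
      (fun i => by rw [integral_neg, h0, neg_zero]) _ (by positivity)
  filter_upwards [hpos, hneg] with ω h1 h2
  rw [Metric.tendsto_nhds]
  intro ε hε
  obtain ⟨k, hk⟩ := exists_nat_one_div_lt hε
  filter_upwards [h1 k, h2 k, eventually_gt_atTop 0] with n hn1 hn2 hn
  have hn' : (0 : ℝ) < n := by exact_mod_cast hn
  rw [Finset.sum_neg_distrib] at hn2
  rw [Real.dist_eq, sub_zero, abs_div, abs_of_pos hn', div_lt_iff₀ hn', abs_lt]
  have := mul_lt_mul_of_pos_right hk hn'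
  constructor <;> linarith

variable {a b f g : Fin 4 → ℝ} {t : ℕ → ℕ}

lemma integral_letterMeasure {p : Fin 4 → ℝ} (hp : ∀ i, 0 ≤ p i) (f : Fin 4 → ℝ) :
    ∫ i, f i ∂letterMeasure p = ∑ i, p i * f i := by
  have hfin : IsFiniteMeasure (letterMeasure p) := by
    constructor
    simp [letterMeasure]
  rw [integral_fintype (Integrable.of_finite)]
  refine Finset.sum_congr rfl fun i _ => ?_
  rw [measureReal_def, letterMeasure_singleton, ENNReal.toReal_ofReal (hp i), smul_eq_mul]

lemma ae_tendsto_average_blockMeasure (ha : ∀ i, 0 ≤ a i) (hb : ∀ i, 0 ≤ b i)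
    (ha1 : ∑ i, a i = 1) (hb1 : ∑ i, b i = 1) (hf : ∑ i, a i * f i = 0) (hg : ∑ i, b i * g i = 0) :
    ∀ᵐ x ∂blockMeasure a b t, Tendsto
      (fun n : ℕ => (∑ j ∈ Finset.range n, blockVal t f g (j + 1) (x.letter j)) / n)
      atTop (𝓝 0) := by
  have hP := fun j : ℕ => isProbabilityMeasure_blockWeight ha hb ha1 hb1 t (j + 1)
  have hemb : MeasurableEmbedding Boundary.mk := MeasurableEquiv.measurableEmbedding
    ⟨⟨Boundary.mk, Boundary.letter, fun _ => rfl, fun _ => rfl⟩, Boundary.measurable_mk,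
      Boundary.measurable_letter⟩
  -- Pulling back along a measurable embedding avoids showing that the convergence event is
  -- measurable.
  refine hemb.ae_map_iff.2 ?_
  obtain ⟨C, hC⟩ : ∃ C, ∀ i, |f i| ≤ C ∧ |g i| ≤ C := by
    refine ⟨(∑ i, |f i|) + ∑ i, |g i|, fun i => ?_⟩
    have h1 := Finset.single_le_sum (f := fun i => |f i|) (fun i _ => abs_nonneg _)
      (Finset.mem_univ i)
    have h2 := Finset.single_le_sum (f := fun i => |g i|) (fun i _ => abs_nonneg _)
      (Finset.mem_univ i)
    have h3 := abs_nonneg (f i)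
    have h4 := abs_nonneg (g i)
    constructor <;> linarith
  refine ae_tendsto_average_of_iIndepFun
    (X := fun (j : ℕ) (x : ℕ → Fin 4) => blockVal t f g (j + 1) (x j)) (C := C)
    (fun j => (measurable_of_finite _).comp (measurable_pi_apply j))
    (ProbabilityTheory.iIndepFun_infinitePi fun j => measurable_of_finite _) ?_ ?_
  · intro j x
    rcases blockVal_cases t f g (j + 1) with h | h <;> rw [h]
    exacts [(hC _).1, (hC _).2]
  · intro j
    have h1 := (measurePreserving_eval_infinitePi
      (fun j : ℕ => letterMeasure (blockWeight a b t (j + 1))) j).map_eq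
    have h2 := integral_map (μ := Measure.infinitePi
      fun j : ℕ => letterMeasure (blockWeight a b t (j + 1))) (φ := Function.eval j)
      (measurable_pi_apply j).aemeasurable
      (f := blockVal t f g (j + 1)) (measurable_of_finite _).aestronglyMeasurable
    rw [h1] at h2
    refine h2.symm.trans ?_
    rw [integral_letterMeasure]
    · simp only [blockWeight_eq_blockVal, blockVal]
      split_ifs <;> assumption
    · intro i
      rcases blockVal_cases t a b (j + 1) with h | h <;> rw [blockWeight_eq_blockVal, h]
      exacts [ha i, hb i]

/-! ### Comparison of sums of linear growth with n * c -/

section Linear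

variable {φ : ℕ → ℕ} {P : ℕ → ℝ} {v c : ℝ}

lemma tendsto_sub_mul_atBot (hφ : Tendsto φ atTop atTop)
    (hP : Tendsto (fun k => P (φ k) / φ k) atTop (𝓝 v)) (h : v < c) :
    Tendsto (fun k => P (φ k) - φ k * c) atTop atBot := by
  have h1 := (tendsto_natCast_atTop_atTop (R := ℝ)).comp hφ
  refine (h1.atTop_mul_neg (sub_neg.2 h) (hP.sub_const c)).congr' ?_
  filter_upwards [hφ.eventually (eventually_gt_atTop 0)] with k hk
  have : (φ k : ℝ) ≠ 0 := by positivity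
  simp only [Function.comp]
  field_simp

lemma tendsto_sub_mul_atTop (hφ : Tendsto φ atTop atTop)
    (hP : Tendsto (fun k => P (φ k) / φ k) atTop (𝓝 v)) (h : c < v) :
    Tendsto (fun k => P (φ k) - φ k * c) atTop atTop := by
  have h1 := (tendsto_natCast_atTop_atTop (R := ℝ)).comp hφ
  refine (h1.atTop_mul_pos (sub_pos.2 h) (hP.sub_const c)).congr' ?_
  filter_upwards [hφ.eventually (eventually_gt_atTop 0)] with k hk
  have : (φ k : ℝ) ≠ 0 := by positivity
  simp only [Function.comp]
  field_simp

lemma tendsto_sub_mul_atBot_of_le (hP : ∀ n : ℕ, P n ≤ n * v) (h : v < c) :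
    Tendsto (fun n : ℕ => P n - n * c) atTop atBot := by
  refine tendsto_atBot_mono (fun n => ?_)
    ((tendsto_natCast_atTop_atTop (R := ℝ)).atTop_mul_const_of_neg (sub_neg.2 h))
  have := hP n
  linarith

lemma tendsto_sub_mul_atTop_of_le (hP : ∀ n : ℕ, n * v ≤ P n) (h : c < v) :
    Tendsto (fun n : ℕ => P n - n * c) atTop atTop := by
  refine tendsto_atTop_mono (fun n => ?_)
    ((tendsto_natCast_atTop_atTop (R := ℝ)).atTop_mul_const (sub_pos.2 h))
  have := hP n
  linarith

end Linear

/-! ### Minima of αq + pressure -/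

section Pressure

variable {p : Fin 4 → ℝ} {α : ℝ}

lemma mul_logb_le_pressure (hp : ∀ i, 0 < p i) (q : ℝ) (i : Fin 4) :
    q * Real.logb 4 (p i) ≤ pressure p q := by
  rw [← Real.logb_rpow_eq_mul_logb_of_pos (hp i)]
  exact Real.logb_le_logb_of_le (by norm_num) (Real.rpow_pos_of_pos (hp i) q)
    (Finset.single_le_sum (f := fun i => p i ^ q)
      (fun j _ => (Real.rpow_pos_of_pos (hp j) q).le) (Finset.mem_univ i))

lemma hasDerivAt_pressure (hp : ∀ i, 0 < p i) (q : ℝ) :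
    HasDerivAt (pressure p) (∑ i, gibbs p q i * Real.logb 4 (p i)) q := by
  have h1 : HasDerivAt (fun q => ∑ i, p i ^ q) (∑ i, p i ^ q * Real.log (p i)) q :=
    HasDerivAt.fun_sum fun i _ => (Real.hasStrictDerivAt_const_rpow (hp i) q).hasDerivAt
  have h2 : HasDerivAt (pressure p) _ q :=
    (h1.log (sum_rpow_pos hp q).ne').div_const (Real.log 4)
  convert h2 using 1
  simp only [gibbs, Real.logb]
  rw [Finset.sum_div, Finset.sum_div]
  exact Finset.sum_congr rfl fun i _ => by ring

/-- Coercivity gives a minimiser. The derivative of the pressure is the Gibbs mean of log_4 p_i, so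
its vanishing condition says that -log_4 p_i has Gibbs mean α. -/
lemma exists_min_pressure (hp : ∀ i, 0 < p i)
    (hc : Tendsto (fun q => α * q + pressure p q) (cocompact ℝ) atTop) :
    ∃ q₀, (∀ q, α * q₀ + pressure p q₀ ≤ α * q + pressure p q) ∧
      ∑ i, gibbs p q₀ i * (-Real.logb 4 (p i) - α) = 0 := by
  have hd : ∀ q, HasDerivAt (fun q => α * q + pressure p q)
      (α * 1 + ∑ i, gibbs p q i * Real.logb 4 (p i)) q := fun q =>
    ((hasDerivAt_id q).const_mul α).add (hasDerivAt_pressure hp q)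
  have hcont : Continuous fun q => α * q + pressure p q :=
    continuous_iff_continuousAt.2 fun q => (hd q).continuousAt
  obtain ⟨q₀, hq₀⟩ := hcont.exists_forall_le hc
  refine ⟨q₀, hq₀, ?_⟩
  have h0 := IsLocalMin.hasDerivAt_eq_zero (Eventually.of_forall hq₀) (hd q₀)
  simp only [mul_sub, Finset.sum_sub_distrib, ← Finset.sum_mul, sum_gibbs hp, mul_neg,
    Finset.sum_neg_distrib]
  linarith

/-- Keeping a single letter of the sum bounds the function below by a line: letter j gives negative
slope for q → -∞, letter i positive slope for q → +∞. -/
lemma tendsto_cocompact_pressure (hp : ∀ i, 0 < p i) {i j : Fin 4}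
    (hi : -Real.logb 4 (p i) < α) (hj : α < -Real.logb 4 (p j)) :
    Tendsto (fun q => α * q + pressure p q) (cocompact ℝ) atTop := by
  rw [cocompact_eq_atBot_atTop, tendsto_sup]
  constructor
  · refine tendsto_atTop_mono (fun q => ?_)
      (tendsto_id.atBot_mul_const_of_neg (show α + Real.logb 4 (p j) < 0 by linarith))
    have := mul_logb_le_pressure hp q j
    simp only [id]
    linarith
  · refine tendsto_atTop_mono (fun q => ?_)
      (tendsto_id.atTop_mul_const (show 0 < α + Real.logb 4 (p i) by linarith))
    have := mul_logb_le_pressure hp q i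
    simp only [id]
    linarith

lemma mul_add_pressure_nonneg (hp : ∀ i, 0 < p i) {i j : Fin 4}
    (hi : -Real.logb 4 (p i) < α) (hj : α < -Real.logb 4 (p j)) (q : ℝ) :
    0 ≤ α * q + pressure p q := by
  have h1 := mul_logb_le_pressure hp q i
  have h2 := mul_logb_le_pressure hp q j
  rcases le_total 0 q with h | h <;> nlinarith

end Pressure

/-! ### The multifractal functions of the block measure -/

section Multifractal

variable {a b : Fin 4 → ℝ} {t : ℕ → ℕ}

lemma support_blockMeasure (ha : ∀ i, 0 < a i) (hb : ∀ i, 0 < b i)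
    (ha1 : ∑ i, a i = 1) (hb1 : ∑ i, b i = 1) : (blockMeasure a b t).support = Set.univ := by
  have : (blockMeasure a b t).IsOpenPosMeasure := by
    refine ⟨fun U hU ⟨x, hx⟩ h0 => ?_⟩
    obtain ⟨n, hn⟩ := (Boundary.isOpen_iff U).1 hU x hx
    have h1 := measure_mono_null hn h0
    change blockMeasure a b t (x.pre (n + 1)) = 0 at h1
    rw [blockMeasure_pre ha hb ha1 hb1] at h1
    simp at h1
  exact Measure.support_eq_univ

lemma blockMeasure_pre_rpow (ha : ∀ i, 0 < a i) (hb : ∀ i, 0 < b i)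
    (ha1 : ∑ i, a i = 1) (hb1 : ∑ i, b i = 1) (q : ℝ) (x : Boundary) (n : ℕ) :
    blockMeasure a b t (x.pre n) ^ q = 4 ^ blockSum t (pressure a q) (pressure b q) n *
      blockMeasure (gibbs a q) (gibbs b q) t (x.pre n) := by
  rw [blockMeasure_pre ha hb ha1 hb1, blockMeasure_pre (gibbs_pos ha q) (gibbs_pos hb q)
    (sum_gibbs ha q) (sum_gibbs hb q), cost_gibbs ha hb, ← ENNReal.rpow_mul, ← four_rpow_add]
  congr 1
  ring

lemma isProbabilityMeasure_gibbs (ha : ∀ i, 0 < a i) (hb : ∀ i, 0 < b i) (q q' : ℝ) :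
    IsProbabilityMeasure (blockMeasure (gibbs a q) (gibbs b q') t) :=
  isProbabilityMeasure_blockMeasure (fun i => (gibbs_pos ha q i).le)
    (fun i => (gibbs_pos hb q' i).le) (sum_gibbs ha q) (sum_gibbs hb q') t

lemma bFun_blockMeasure (ha : ∀ i, 0 < a i) (hb : ∀ i, 0 < b i)
    (ha1 : ∑ i, a i = 1) (hb1 : ∑ i, b i = 1) (ht : ∀ k, 1 ≤ k → t k < t (k + 1))
    (htlim : Tendsto (fun k => (t (k + 1) : ℝ) / (t k : ℝ)) atTop atTop) {q : ℝ}
    (hq : pressure b q ≤ pressure a q) : bFun (blockMeasure a b t) q = pressure b q := by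
  have := isProbabilityMeasure_gibbs (t := t) ha hb q q
  set ν := blockMeasure (gibbs a q) (gibbs b q) t
  have hpre := blockMeasure_pre_rpow (t := t) ha hb ha1 hb1 q
  refine le_antisymm ((EReal.le_of_forall_lt_iff_le).1 fun s hs => ?_)
    (le_iInf fun s => le_iInf fun hs => ?_)
  · rw [EReal.coe_lt_coe_iff] at hs
    refine iInf_le_of_le s (iInf_le _ ?_)
    refine methodI_eq_zero (fun _ => Set.univ) (Set.subset_iUnion_of_subset 0
      (Set.subset_univ _)) fun _ => lowerPre_eq_zero ?_
    exact Boundary.liminf_packingSum_eq_zero (ν := ν) (tendsto_secondEnd ht)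
      (Eventually.of_forall fun n x _ => (hpre x n).le) (tendsto_sub_mul_atBot
        (tendsto_secondEnd ht) (tendsto_blockSum_secondEnd ht htlim _ _) hs)
  · rw [EReal.coe_le_coe_iff]
    by_contra! hlt
    refine ENNReal.top_ne_zero (Eq.trans (Eq.symm ?_) hs)
    rw [support_blockMeasure ha hb ha1 hb1]
    refine methodI_eq_top ν (by simp) fun U hU => ?_
    rw [Set.inter_univ] at hU
    -- The exact identity for μ^q holds on all cylinders, so the piece itself can serve as the
    -- subset in the supremum.
    refine top_le_iff.1 (le_iSup_of_le U (le_iSup_of_le subset_rfl (le_of_eq (Eq.symm ?_))))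
    exact Boundary.lowerL_eq_top hU (Eventually.of_forall fun n x _ => (hpre x n).ge)
      (tendsto_sub_mul_atTop_of_le (fun n => le_blockSum hq le_rfl n) hlt)

lemma BFun_blockMeasure (ha : ∀ i, 0 < a i) (hb : ∀ i, 0 < b i)
    (ha1 : ∑ i, a i = 1) (hb1 : ∑ i, b i = 1) (ht : ∀ k, 1 ≤ k → t k < t (k + 1))
    (htlim : Tendsto (fun k => (t (k + 1) : ℝ) / (t k : ℝ)) atTop atTop) {q : ℝ}
    (hq : pressure b q ≤ pressure a q) : BFun (blockMeasure a b t) q = pressure a q := by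
  have := isProbabilityMeasure_gibbs (t := t) ha hb q q
  set ν := blockMeasure (gibbs a q) (gibbs b q) t
  have hpre := blockMeasure_pre_rpow (t := t) ha hb ha1 hb1 q
  refine le_antisymm ((EReal.le_of_forall_lt_iff_le).1 fun s hs => ?_)
    (le_iInf fun s => le_iInf fun hs => ?_)
  · rw [EReal.coe_lt_coe_iff] at hs
    refine iInf_le_of_le s (iInf_le _ ?_)
    refine methodI_eq_zero (fun _ => Set.univ) (Set.subset_iUnion_of_subset 0
      (Set.subset_univ _)) fun _ => ?_
    exact Boundary.upperPre_eq_zero (ν := ν) (Eventually.of_forall fun n x _ => (hpre x n).le)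
      (tendsto_sub_mul_atBot_of_le (fun n => blockSum_le le_rfl hq n) hs)
  · rw [EReal.coe_le_coe_iff]
    by_contra! hlt
    refine ENNReal.top_ne_zero (Eq.trans (Eq.symm ?_) hs)
    rw [support_blockMeasure ha hb ha1 hb1]
    refine methodI_eq_top ν (by simp) fun U hU => ?_
    rw [Set.inter_univ] at hU
    exact Boundary.upperPre_eq_top hU (tendsto_firstEnd ht)
      (Eventually.of_forall fun n x _ => (hpre x n).ge) (tendsto_sub_mul_atTop
        (tendsto_firstEnd ht) (tendsto_blockSum_firstEnd ht htlim _ _) hlt)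

end Multifractal

/-! ### The level set in terms of cylinders -/

section LevelSet

variable {a b : Fin 4 → ℝ} {t : ℕ → ℕ} {α : ℝ}

lemma tendsto_level_div : Tendsto (fun r : ℝ => (Boundary.level r : ℝ) / -Real.logb 4 r)
    (𝓝[>] 0) (𝓝 1) := by
  have h : Tendsto (fun r : ℝ => -Real.logb 4 r) (𝓝[>] 0) atTop :=
    tendsto_neg_atBot_atTop.comp (Real.tendsto_logb_nhdsGT_zero (by norm_num))
  have h1 : Tendsto (fun r : ℝ => 1 + (-Real.logb 4 r)⁻¹) (𝓝[>] 0) (𝓝 1) := by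
    simpa using h.inv_tendsto_atTop.const_add 1
  refine tendsto_of_tendsto_of_tendsto_of_le_of_le' tendsto_const_nhds h1 ?_ ?_
  all_goals
    filter_upwards [Ioc_mem_nhdsGT one_pos, h.eventually (eventually_gt_atTop 0)] with r hr hpos
    have h2 := Boundary.logb_le_of_level hr.1 hr.2
    have h3 := Boundary.lt_logb_of_level r
  · rw [le_div_iff₀ hpos]
    linarith
  · rw [div_le_iff₀ hpos, add_mul, inv_mul_cancel₀ hpos.ne']
    linarith

/-- The quotient log μ(B(x,r)) / log r is the mean cost at length `level r` times a factor tending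
to 1, so the limit over radii becomes a limit over lengths. -/
lemma mem_levelSet_iff (ha : ∀ i, 0 < a i) (hb : ∀ i, 0 < b i)
    (ha1 : ∑ i, a i = 1) (hb1 : ∑ i, b i = 1) (x : Boundary) :
    x ∈ levelSet (blockMeasure a b t) α ↔
      Tendsto (fun n : ℕ => cost a b t n x / n) atTop (𝓝 α) := by
  set u : ℝ → ℝ := fun r => Real.log ((blockMeasure a b t).real (Metric.ball x r)) / Real.log r
    with hu
  set w : ℝ → ℝ := fun r => cost a b t (Boundary.level r) x / Boundary.level r with hw
  have huw : u =ᶠ[𝓝[>] 0] fun r => w r * ((Boundary.level r : ℝ) / -Real.logb 4 r) := by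
    filter_upwards [Ioc_mem_nhdsGT one_pos] with r hr
    have hl : (Boundary.level r : ℝ) ≠ 0 := by
      rw [Boundary.level]
      positivity
    simp only [hu, hw]
    rw [Boundary.ball_eq_pre hr.1 hr.2, measureReal_def, blockMeasure_pre ha hb ha1 hb1,
      four_rpow_eq_ofReal, ENNReal.toReal_ofReal (by positivity), Real.log_rpow (by norm_num),
      div_mul_div_cancel₀ hl, Real.logb, neg_mul, div_neg, div_div_eq_mul_div, neg_div]
  have hwu : w =ᶠ[𝓝[>] 0] fun r => u r * ((Boundary.level r : ℝ) / -Real.logb 4 r)⁻¹ := by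
    filter_upwards [huw, tendsto_level_div.eventually_ne one_ne_zero] with r h1 h2
    rw [h1, mul_inv_cancel_right₀ h2]
  have h1 : Tendsto u (𝓝[>] 0) (𝓝 α) ↔ Tendsto w (𝓝[>] 0) (𝓝 α) := by
    constructor <;> intro h
    · simpa using (h.mul (tendsto_level_div.inv₀ one_ne_zero)).congr' hwu.symm
    · simpa using (h.mul tendsto_level_div).congr' huw.symm
  have h2 : Tendsto w (𝓝[>] 0) (𝓝 α) ↔
      Tendsto (fun n : ℕ => cost a b t n x / n) atTop (𝓝 α) := by
    constructor <;> intro h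
    · refine (h.comp Boundary.tendsto_radius).congr' ?_
      filter_upwards [eventually_ge_atTop 1] with n hn
      simp only [hw, Function.comp, Boundary.level_radius hn]
    · exact h.comp Boundary.tendsto_level
  rw [← h2, ← h1, ← EReal.tendsto_coe]
  constructor
  · rintro ⟨-, h3, h4⟩
    exact tendsto_of_le_liminf_of_limsup_le h3 h4
  · intro h
    refine ⟨?_, h.liminf_eq.ge, h.limsup_eq.le⟩
    rw [support_blockMeasure ha hb ha1 hb1]
    trivial

end LevelSet

/-! ### Upper bounds for the dimensions of the level set -/

section UpperBound

variable {a b : Fin 4 → ℝ} {t : ℕ → ℕ} {α : ℝ}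

lemma exists_cover_levelSet (ha : ∀ i, 0 < a i) (hb : ∀ i, 0 < b i)
    (ha1 : ∑ i, a i = 1) (hb1 : ∑ i, b i = 1) (q : ℝ) {ε : ℝ} (hε : 0 < ε) :
    ∃ U : ℕ → Set Boundary, levelSet (blockMeasure a b t) α ⊆ ⋃ m, U m ∧
      ∀ m, ∀ᶠ n : ℕ in atTop, ∀ x ∈ U m,
        1 ≤ 4 ^ (blockSum t (pressure a q) (pressure b q) n + n * (α * q + ε)) *
          blockMeasure (gibbs a q) (gibbs b q) t (x.pre n) := by
  -- The pieces make the estimate uniform from length m on. Bounding q times the cost, rather than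
  -- the cost, treats both signs of q together.
  refine ⟨fun m => {x | ∀ n : ℕ, m ≤ n → q * cost a b t n x ≤ n * (α * q + ε)}, fun x hx => ?_,
    fun m => ?_⟩
  · rw [mem_levelSet_iff ha hb ha1 hb1] at hx
    have h1 := (hx.const_mul q).eventually
      (gt_mem_nhds (show q * α < α * q + ε by linarith [mul_comm q α]))
    obtain ⟨m, hm⟩ := eventually_atTop.1 (h1.and (eventually_gt_atTop 0))
    refine Set.mem_iUnion.2 ⟨m, fun n hn => ?_⟩
    obtain ⟨h2, h3⟩ := hm n hn
    have h4 : (0 : ℝ) < n := by exact_mod_cast h3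
    rw [← mul_div_assoc, div_lt_iff₀ h4] at h2
    linarith
  · filter_upwards [eventually_ge_atTop m] with n hn x hx
    rw [blockMeasure_pre (gibbs_pos ha q) (gibbs_pos hb q) (sum_gibbs ha q) (sum_gibbs hb q),
      cost_gibbs ha hb, ← four_rpow_add, ← ENNReal.rpow_zero (x := 4)]
    refine four_rpow_mono ?_
    have := hx n hn
    linarith

lemma exists_cover_liminf_packingSum_eq_zero (ha : ∀ i, 0 < a i) (hb : ∀ i, 0 < b i)
    (ha1 : ∑ i, a i = 1) (hb1 : ∑ i, b i = 1) (ht : ∀ k, 1 ≤ k → t k < t (k + 1))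
    (htlim : Tendsto (fun k => (t (k + 1) : ℝ) / (t k : ℝ)) atTop atTop) {q s : ℝ}
    (hs : α * q + pressure b q < s) :
    ∃ U : ℕ → Set Boundary, levelSet (blockMeasure a b t) α ⊆ ⋃ m, U m ∧ ∀ m,
      liminf (fun r : ℝ => packingSum (fun _ => 1) r (U m) * ENNReal.ofReal (2 * r) ^ s)
        (𝓝[>] 0) = 0 := by
  have := isProbabilityMeasure_gibbs (t := t) ha hb q q
  obtain ⟨ε, hε, hεs⟩ := exists_between (sub_pos.2 hs)
  obtain ⟨U, hU, h⟩ := exists_cover_levelSet (t := t) (α := α) ha hb ha1 hb1 q hε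
  refine ⟨U, hU, fun m => Boundary.liminf_packingSum_eq_zero (tendsto_secondEnd ht) (h m) ?_⟩
  refine (tendsto_sub_mul_atBot (tendsto_secondEnd ht)
    (tendsto_blockSum_secondEnd ht htlim (pressure a q) (pressure b q))
    (show pressure b q < s - (α * q + ε) by linarith)).congr fun k => ?_
  ring

lemma lowerHS_levelSet_eq_zero (ha : ∀ i, 0 < a i) (hb : ∀ i, 0 < b i)
    (ha1 : ∑ i, a i = 1) (hb1 : ∑ i, b i = 1) (ht : ∀ k, 1 ≤ k → t k < t (k + 1))
    (htlim : Tendsto (fun k => (t (k + 1) : ℝ) / (t k : ℝ)) atTop atTop) {q s : ℝ}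
    (hs : α * q + pressure b q < s) : lowerHS s (levelSet (blockMeasure a b t) α) = 0 := by
  obtain ⟨U, hU, h⟩ := exists_cover_liminf_packingSum_eq_zero ha hb ha1 hb1 ht htlim hs
  exact methodI_eq_zero U hU fun m => lowerPre_eq_zero (h m)

lemma hausdorffMeasure_levelSet_eq_zero (ha : ∀ i, 0 < a i) (hb : ∀ i, 0 < b i)
    (ha1 : ∑ i, a i = 1) (hb1 : ∑ i, b i = 1) (ht : ∀ k, 1 ≤ k → t k < t (k + 1))
    (htlim : Tendsto (fun k => (t (k + 1) : ℝ) / (t k : ℝ)) atTop atTop) {q s : ℝ} (hs0 : 0 ≤ s)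
    (hs : α * q + pressure b q < s) : μH[s] (levelSet (blockMeasure a b t) α) = 0 := by
  obtain ⟨U, hU, h⟩ := exists_cover_liminf_packingSum_eq_zero ha hb ha1 hb1 ht htlim hs
  exact measure_mono_null hU (measure_iUnion_null fun m =>
    hausdorffMeasure_eq_zero_of_liminf_packingSum hs0 (h m))

lemma packingMeasure_levelSet_eq_zero (ha : ∀ i, 0 < a i) (hb : ∀ i, 0 < b i)
    (ha1 : ∑ i, a i = 1) (hb1 : ∑ i, b i = 1) {q s : ℝ} (hq : pressure b q ≤ pressure a q)
    (hs : α * q + pressure a q < s) :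
    packingMeasure s (levelSet (blockMeasure a b t) α) = 0 := by
  have := isProbabilityMeasure_gibbs (t := t) ha hb q q
  obtain ⟨ε, hε, hεs⟩ := exists_between (sub_pos.2 hs)
  obtain ⟨U, hU, h⟩ := exists_cover_levelSet (t := t) (α := α) ha hb ha1 hb1 q hε
  refine methodI_eq_zero U hU fun m => Boundary.packingPre_eq_zero (h m) ?_
  refine (tendsto_sub_mul_atBot_of_le (fun n => blockSum_le (t := t) le_rfl hq n)
    (show pressure a q < s - (α * q + ε) by linarith)).congr fun n => ?_
  ring

end UpperBound

/-! ### Lower bounds from a measure carried by the level set -/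

section LowerBound

variable {a b : Fin 4 → ℝ} {t : ℕ → ℕ} {α q₀ q₁ : ℝ}

lemma sum_gibbs_mul_const_mul {p : Fin 4 → ℝ} {q : ℝ}
    (hq : ∑ i, gibbs p q i * (-Real.logb 4 (p i) - α) = 0) (c : ℝ) :
    ∑ i, gibbs p q i * (c * (-Real.logb 4 (p i) - α)) = 0 := by
  simp_rw [mul_left_comm, ← Finset.mul_sum, hq, mul_zero]

lemma ae_mem_levelSet (ha : ∀ i, 0 < a i) (hb : ∀ i, 0 < b i)
    (ha1 : ∑ i, a i = 1) (hb1 : ∑ i, b i = 1)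
    (hq₁ : ∑ i, gibbs a q₁ i * (-Real.logb 4 (a i) - α) = 0)
    (hq₀ : ∑ i, gibbs b q₀ i * (-Real.logb 4 (b i) - α) = 0) :
    ∀ᵐ x ∂blockMeasure (gibbs a q₁) (gibbs b q₀) t, x ∈ levelSet (blockMeasure a b t) α := by
  filter_upwards [ae_tendsto_average_blockMeasure (t := t) (fun i => (gibbs_pos ha q₁ i).le)
    (fun i => (gibbs_pos hb q₀ i).le) (sum_gibbs ha q₁) (sum_gibbs hb q₀) hq₁ hq₀] with x hx
  rw [mem_levelSet_iff ha hb ha1 hb1]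
  have h := hx.add_const α
  rw [zero_add] at h
  refine h.congr' ?_
  filter_upwards [eventually_gt_atTop 0] with n hn
  have hn' : (n : ℝ) ≠ 0 := by positivity
  have : ∀ j, blockVal t (fun i => -Real.logb 4 (a i) - α) (fun i => -Real.logb 4 (b i) - α) (j + 1)
      (x.letter j) = -Real.logb 4 (blockWeight a b t (j + 1) (x.letter j)) - α := by
    intro j
    simp only [blockWeight_eq_blockVal, blockVal]
    split_ifs <;> rfl
  simp only [this, Finset.sum_sub_distrib, cost]
  rw [Finset.sum_const, Finset.card_range, nsmul_eq_mul]
  field_simp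
  ring

/-- A letter of Gibbs weight costs (αq + pressure) + q(-log_4 p - α), and the last term is centred;
the strong law is applied with factor q₁ in the a-blocks and q₀ in the b-blocks. -/
lemma ae_tendsto_cost (ha : ∀ i, 0 < a i) (hb : ∀ i, 0 < b i)
    (hq₁ : ∑ i, gibbs a q₁ i * (-Real.logb 4 (a i) - α) = 0)
    (hq₀ : ∑ i, gibbs b q₀ i * (-Real.logb 4 (b i) - α) = 0) :
    ∀ᵐ x ∂blockMeasure (gibbs a q₁) (gibbs b q₀) t,
      Tendsto (fun n : ℕ => (cost (gibbs a q₁) (gibbs b q₀) t n x -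
        blockSum t (α * q₁ + pressure a q₁) (α * q₀ + pressure b q₀) n) / n) atTop (𝓝 0) := by
  filter_upwards [ae_tendsto_average_blockMeasure (t := t) (fun i => (gibbs_pos ha q₁ i).le)
    (fun i => (gibbs_pos hb q₀ i).le) (sum_gibbs ha q₁) (sum_gibbs hb q₀)
    (sum_gibbs_mul_const_mul hq₁ q₁) (sum_gibbs_mul_const_mul hq₀ q₀)] with x hx
  refine hx.congr fun n => ?_
  congr 1
  rw [cost, blockSum, ← Finset.sum_sub_distrib]
  refine Finset.sum_congr rfl fun j _ => ?_
  simp only [blockWeight_eq_blockVal, blockVal]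
  split_ifs
  · rw [neg_logb_gibbs ha]
    ring
  · rw [neg_logb_gibbs hb]
    ring

/-- The points of the level set at which the measure of the cylinders of length `n ≥ m` is at
most `4 ^ (-(blockSum t γ β n - n * ε))`. -/
def regularSet (a b a' b' : Fin 4 → ℝ) (t : ℕ → ℕ) (α γ β ε : ℝ) (m : ℕ) : Set Boundary :=
  {x ∈ levelSet (blockMeasure a b t) α | ∀ n : ℕ, m ≤ n →
    blockSum t γ β n - n * ε ≤ cost a' b' t n x}

lemma ae_mem_iUnion_regularSet (ha : ∀ i, 0 < a i) (hb : ∀ i, 0 < b i)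
    (ha1 : ∑ i, a i = 1) (hb1 : ∑ i, b i = 1)
    (hq₁ : ∑ i, gibbs a q₁ i * (-Real.logb 4 (a i) - α) = 0)
    (hq₀ : ∑ i, gibbs b q₀ i * (-Real.logb 4 (b i) - α) = 0) {ε : ℝ} (hε : 0 < ε) :
    ∀ᵐ x ∂blockMeasure (gibbs a q₁) (gibbs b q₀) t,
      x ∈ ⋃ m, regularSet a b (gibbs a q₁) (gibbs b q₀) t α
        (α * q₁ + pressure a q₁) (α * q₀ + pressure b q₀) ε m := by
  filter_upwards [ae_mem_levelSet (t := t) ha hb ha1 hb1 hq₁ hq₀,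
    ae_tendsto_cost (t := t) ha hb hq₁ hq₀] with x h1 h2
  obtain ⟨m, hm⟩ := eventually_atTop.1
    ((h2.eventually (lt_mem_nhds (neg_lt_zero.2 hε))).and (eventually_gt_atTop 0))
  refine Set.mem_iUnion.2 ⟨m, h1, fun n hn => ?_⟩
  obtain ⟨h3, h4⟩ := hm n hn
  have h5 : (0 : ℝ) < n := by exact_mod_cast h4
  rw [lt_div_iff₀ h5] at h3
  linarith

lemma four_rpow_mul_le_one_of_mem_regularSet {a' b' : Fin 4 → ℝ} (ha' : ∀ i, 0 < a' i)
    (hb' : ∀ i, 0 < b' i) (ha1' : ∑ i, a' i = 1) (hb1' : ∑ i, b' i = 1) {γ β ε : ℝ} {m n : ℕ}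
    (hn : m ≤ n) {x : Boundary} (hx : x ∈ regularSet a b a' b' t α γ β ε m) :
    4 ^ (blockSum t γ β n - n * ε) * blockMeasure a' b' t (x.pre n) ≤ 1 := by
  rw [blockMeasure_pre ha' hb' ha1' hb1', ← four_rpow_add, ← ENNReal.rpow_zero (x := 4)]
  refine four_rpow_mono ?_
  have := hx.2 n hn
  linarith

lemma exists_inter_ne_zero {Ω : Type*} [MeasurableSpace Ω] {ν : Measure Ω} {G : ℕ → Set Ω}
    (hG : ∀ᵐ x ∂ν, x ∈ ⋃ m, G m) {U : Set Ω} (hU : ν U ≠ 0) : ∃ m, ν (U ∩ G m) ≠ 0 := by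
  by_contra! h
  refine hU (measure_mono_null (fun x hx => ?_) (measure_union_null (measure_iUnion_null h) hG))
  by_cases hxG : x ∈ ⋃ m, G m
  · obtain ⟨m, hm⟩ := Set.mem_iUnion.1 hxG
    exact Or.inl (Set.mem_iUnion.2 ⟨m, hx, hm⟩)
  · exact Or.inr hxG

lemma measure_levelSet_ne_zero (ha : ∀ i, 0 < a i) (hb : ∀ i, 0 < b i)
    (ha1 : ∑ i, a i = 1) (hb1 : ∑ i, b i = 1)
    (hq₁ : ∑ i, gibbs a q₁ i * (-Real.logb 4 (a i) - α) = 0)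
    (hq₀ : ∑ i, gibbs b q₀ i * (-Real.logb 4 (b i) - α) = 0) :
    blockMeasure (gibbs a q₁) (gibbs b q₀) t (levelSet (blockMeasure a b t) α) ≠ 0 := by
  have := isProbabilityMeasure_gibbs (t := t) ha hb q₁ q₀
  intro h
  obtain ⟨x, h1, h2⟩ := ((ae_mem_levelSet (t := t) ha hb ha1 hb1 hq₁ hq₀).and
    (measure_eq_zero_iff_ae_notMem.1 h)).exists
  exact h2 h1

lemma lowerHS_levelSet_eq_top (ha : ∀ i, 0 < a i) (hb : ∀ i, 0 < b i)
    (ha1 : ∑ i, a i = 1) (hb1 : ∑ i, b i = 1)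
    (hq₁ : ∑ i, gibbs a q₁ i * (-Real.logb 4 (a i) - α) = 0)
    (hq₀ : ∑ i, gibbs b q₀ i * (-Real.logb 4 (b i) - α) = 0)
    (hle : α * q₀ + pressure b q₀ ≤ α * q₁ + pressure a q₁) {s : ℝ}
    (hs : s < α * q₀ + pressure b q₀) : lowerHS s (levelSet (blockMeasure a b t) α) = ∞ := by
  set ν := blockMeasure (gibbs a q₁) (gibbs b q₀) t
  refine methodI_eq_top ν (measure_levelSet_ne_zero ha hb ha1 hb1 hq₁ hq₀) fun U hU => ?_
  obtain ⟨ε, hε, hεs⟩ := exists_between (sub_pos.2 hs)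
  obtain ⟨m, hm⟩ := exists_inter_ne_zero
    (ae_mem_iUnion_regularSet (t := t) ha hb ha1 hb1 hq₁ hq₀ hε) hU
  -- The lower pre-measure is a supremum over subsets, so it may be tested on the part of the piece
  -- where the cylinder bound is uniform and which still has positive mass.
  refine top_le_iff.1 (le_iSup_of_le _ (le_iSup_of_le
    (Set.inter_subset_left.trans Set.inter_subset_left) (le_of_eq (Eq.symm
      (Boundary.lowerL_eq_top (s := fun n => blockSum t (α * q₁ + pressure a q₁)
        (α * q₀ + pressure b q₀) n - n * ε) hm ?_ ?_)))))
  · filter_upwards [eventually_ge_atTop m] with n hn x hx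
    exact four_rpow_mul_le_one_of_mem_regularSet (gibbs_pos ha q₁) (gibbs_pos hb q₀)
      (sum_gibbs ha q₁) (sum_gibbs hb q₀) hn hx.2
  · refine (tendsto_sub_mul_atTop_of_le (fun n => le_blockSum (t := t) hle le_rfl n)
      (show s + ε < _ by linarith)).congr fun n => ?_
    ring

lemma hausdorffMeasure_levelSet_ne_zero (ha : ∀ i, 0 < a i) (hb : ∀ i, 0 < b i)
    (ha1 : ∑ i, a i = 1) (hb1 : ∑ i, b i = 1)
    (hq₁ : ∑ i, gibbs a q₁ i * (-Real.logb 4 (a i) - α) = 0)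
    (hq₀ : ∑ i, gibbs b q₀ i * (-Real.logb 4 (b i) - α) = 0)
    (hle : α * q₀ + pressure b q₀ ≤ α * q₁ + pressure a q₁) {s : ℝ} (hs0 : 0 < s)
    (hs : s < α * q₀ + pressure b q₀) : μH[s] (levelSet (blockMeasure a b t) α) ≠ 0 := by
  obtain ⟨ε, hε, hεs⟩ := exists_between (sub_pos.2 hs)
  obtain ⟨m, hm⟩ := exists_inter_ne_zero
    (ae_mem_iUnion_regularSet (t := t) ha hb ha1 hb1 hq₁ hq₀ hε)
    (measure_levelSet_ne_zero ha hb ha1 hb1 hq₁ hq₀)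
  refine fun h0 => Boundary.hausdorffMeasure_ne_zero hs0 hm ?_
    (measure_mono_null Set.inter_subset_left h0)
  filter_upwards [eventually_ge_atTop m] with n hn x hx
  rw [blockMeasure_pre (gibbs_pos ha q₁) (gibbs_pos hb q₀) (sum_gibbs ha q₁) (sum_gibbs hb q₀)]
  refine four_rpow_mono (neg_le_neg ?_)
  have h1 := hx.2.2 n hn
  have h2 := le_blockSum (t := t) hle le_rfl n
  have h3 : (n : ℝ) * (s + ε) ≤ n * (α * q₀ + pressure b q₀) :=
    mul_le_mul_of_nonneg_left (by linarith) n.cast_nonneg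
  linarith

lemma upperHS_levelSet_eq_top (ha : ∀ i, 0 < a i) (hb : ∀ i, 0 < b i)
    (ha1 : ∑ i, a i = 1) (hb1 : ∑ i, b i = 1) (ht : ∀ k, 1 ≤ k → t k < t (k + 1))
    (htlim : Tendsto (fun k => (t (k + 1) : ℝ) / (t k : ℝ)) atTop atTop)
    (hq₁ : ∑ i, gibbs a q₁ i * (-Real.logb 4 (a i) - α) = 0)
    (hq₀ : ∑ i, gibbs b q₀ i * (-Real.logb 4 (b i) - α) = 0) {s : ℝ}
    (hs : s < α * q₁ + pressure a q₁) : upperHS s (levelSet (blockMeasure a b t) α) = ∞ := by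
  set ν := blockMeasure (gibbs a q₁) (gibbs b q₀) t
  refine methodI_eq_top ν (measure_levelSet_ne_zero ha hb ha1 hb1 hq₁ hq₀) fun U hU => ?_
  obtain ⟨ε, hε, hεs⟩ := exists_between (sub_pos.2 hs)
  obtain ⟨m, hm⟩ := exists_inter_ne_zero
    (ae_mem_iUnion_regularSet (t := t) ha hb ha1 hb1 hq₁ hq₀ hε) hU
  refine top_le_iff.1 (le_trans (le_of_eq (Eq.symm (Boundary.upperPre_eq_top
      (s := fun n => blockSum t (α * q₁ + pressure a q₁)
        (α * q₀ + pressure b q₀) n - n * ε) hm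
    (tendsto_firstEnd ht) ?_ ?_))) (upperPre_mono _ _
      (Set.inter_subset_left.trans Set.inter_subset_left)))
  · filter_upwards [eventually_ge_atTop m] with n hn x hx
    exact four_rpow_mul_le_one_of_mem_regularSet (gibbs_pos ha q₁) (gibbs_pos hb q₀)
      (sum_gibbs ha q₁) (sum_gibbs hb q₀) hn hx.2
  · refine (tendsto_sub_mul_atTop (tendsto_firstEnd ht) (tendsto_blockSum_firstEnd ht htlim
      (α * q₁ + pressure a q₁) (α * q₀ + pressure b q₀))
      (show s + ε < _ by linarith)).congr fun n => ?_
    ring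

end LowerBound

/-! ### From critical exponents to the dimension formulas -/

section Assembly

/-- The lower bound is asked for s > 0 only, as the mass distribution principle requires; at 0 it is
trivial. -/
lemma coe_dim_eq {D : ℝ≥0∞} {β : ℝ} (hβ : 0 ≤ β) (hle : ∀ s : ℝ≥0, β < s → D ≤ s)
    (hge : ∀ s : ℝ≥0, 0 < s → (s : ℝ) < β → s ≤ D) : (D : EReal) = (β : EReal) := by
  have hD : D = ENNReal.ofReal β := by
    refine le_antisymm ?_ ?_
    · refine le_of_forall_gt_imp_ge_of_dense fun c hc => ?_
      obtain ⟨s, hs1, hs2⟩ := ENNReal.lt_iff_exists_nnreal_btwn.1 hc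
      refine (hle s ?_).trans hs2.le
      rwa [ENNReal.ofReal_lt_coe_iff hβ] at hs1
    · refine le_of_forall_lt_imp_le_of_dense fun c hc => ?_
      rcases eq_or_ne c 0 with rfl | hc0
      · exact zero_le
      lift c to ℝ≥0 using hc.ne_top
      refine hge c (pos_iff_ne_zero.2 (by exact_mod_cast hc0)) ?_
      rwa [ENNReal.ofReal, ENNReal.coe_lt_coe, Real.lt_toNNReal_iff_coe_lt] at hc
  rw [hD, EReal.coe_ennreal_ofReal, max_eq_left hβ]

lemma iSup_le_of_eq_zero {m : ℝ≥0 → ℝ≥0∞} {s : ℝ≥0} (h : ∀ u : ℝ≥0, s < u → m u = 0) :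
    ⨆ (u : ℝ≥0) (_ : m u = ∞), (u : ℝ≥0∞) ≤ s := by
  refine iSup_le fun u => iSup_le fun hu => ?_
  by_contra! hlt
  exact ENNReal.zero_ne_top ((h u (by exact_mod_cast hlt)).symm.trans hu)

lemma legendre_eq {χ : ℝ → EReal} {f : ℝ → ℝ} (hχ : ∀ q, χ q = f q) {α q₀ : ℝ}
    (h : ∀ q, α * q₀ + f q₀ ≤ α * q + f q) : legendre χ α = ((α * q₀ + f q₀ : ℝ) : EReal) := by
  have : ∀ q, ((α * q : ℝ) : EReal) + χ q = ((α * q + f q : ℝ) : EReal) := fun q => by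
    rw [hχ, EReal.coe_add]
  simp only [legendre, this]
  exact le_antisymm (iInf_le _ q₀) (le_iInf fun q => EReal.coe_le_coe_iff.2 (h q))

end Assembly

end HewittStromberg

open HewittStromberg
theorem mainTheorem12
    (a b : Fin 4 → ℝ)
    (ha : ∀ i, a i ∈ Set.Ioo (0 : ℝ) 1) (hb : ∀ i, b i ∈ Set.Ioo (0 : ℝ) 1)
    (ha_sum : ∑ i, a i = 1) (hb_sum : ∑ i, b i = 1)
    (t : ℕ → ℕ) (ht1 : t 1 = 1) (ht : ∀ k, 1 ≤ k → t k < t (k + 1))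
    (htlim : Tendsto (fun k => (t (k + 1) : ℝ) / (t k : ℝ)) atTop atTop)
    (hab : a 0 < b 0)
    (hgraph : ∀ q : ℝ, Real.logb 4 (∑ i, b i ^ q) ≤ Real.logb 4 (∑ i, a i ^ q))
    (α : ℝ) (hα : α ∈ Set.Ioo (-Real.logb 4 (b 3)) (-Real.logb 4 (b 0))) :
    ((dimH (levelSet (blockMeasure a b t) α) : EReal) =
        legendre (bFun (blockMeasure a b t)) α ∧
      (lowerDimMB (levelSet (blockMeasure a b t) α) : EReal) =
        legendre (bFun (blockMeasure a b t)) α) ∧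
    ((dimP (levelSet (blockMeasure a b t) α) : EReal) =
        legendre (BFun (blockMeasure a b t)) α ∧
      (upperDimMB (levelSet (blockMeasure a b t) α) : EReal) =
        legendre (BFun (blockMeasure a b t)) α) := by
  have ha0 : ∀ i, 0 < a i := fun i => (ha i).1
  have hb0 : ∀ i, 0 < b i := fun i => (hb i).1
  have hpr : ∀ q, pressure b q ≤ pressure a q := hgraph
  have hcb := tendsto_cocompact_pressure hb0 hα.1 hα.2
  obtain ⟨q₀, hmin₀, hq₀⟩ := exists_min_pressure hb0 hcb
  obtain ⟨q₁, hmin₁, hq₁⟩ := exists_min_pressure ha0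
    -- Coercivity for the a-weights is inherited from the b-weights by the ordering of the graphs; α
    -- need not be compared with the a_i.
    (tendsto_atTop_mono (fun q => add_le_add_right (hpr q) (α * q)) hcb)
  have hβ : 0 ≤ α * q₀ + pressure b q₀ := mul_add_pressure_nonneg hb0 hα.1 hα.2 q₀
  have hle : α * q₀ + pressure b q₀ ≤ α * q₁ + pressure a q₁ :=
    (hmin₀ q₁).trans (add_le_add_right (hpr q₁) _)
  rw [legendre_eq (fun q => bFun_blockMeasure ha0 hb0 ha_sum hb_sum ht htlim (hpr q)) hmin₀,
    legendre_eq (fun q => BFun_blockMeasure ha0 hb0 ha_sum hb_sum ht htlim (hpr q)) hmin₁]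
  -- As `upperDimMB_le_dimP` orders the two upper dimensions, a lower bound for the smaller and an
  -- upper bound for the larger settle both.
  have hup : ∀ s : ℝ≥0, (s : ℝ) < α * q₁ + pressure a q₁ →
      (s : ℝ≥0∞) ≤ upperDimMB (levelSet (blockMeasure a b t) α) := fun s hs =>
    le_iSup_of_le s (le_iSup_of_le
      (upperHS_levelSet_eq_top ha0 hb0 ha_sum hb_sum ht htlim hq₁ hq₀ hs) le_rfl)
  have hP : ∀ s : ℝ≥0, α * q₁ + pressure a q₁ < s →
      dimP (levelSet (blockMeasure a b t) α) ≤ s := fun s hs =>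
    iSup_le_of_eq_zero (m := fun u => packingMeasure u (levelSet (blockMeasure a b t) α))
      fun u hu => packingMeasure_levelSet_eq_zero ha0 hb0 ha_sum hb_sum (hpr q₁)
        (hs.trans (NNReal.coe_lt_coe.2 hu))
  refine ⟨⟨coe_dim_eq hβ (fun s hs => ?_) (fun s hs0 hs => ?_),
    coe_dim_eq hβ (fun s hs => ?_) (fun s _ hs => ?_)⟩,
    coe_dim_eq (hβ.trans hle) hP fun s _ hs => (hup s hs).trans (upperDimMB_le_dimP _),
    coe_dim_eq (hβ.trans hle) (fun s hs => (upperDimMB_le_dimP _).trans (hP s hs))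
      fun s _ hs => hup s hs⟩
  · refine dimH_le_of_hausdorffMeasure_ne_top ?_
    rw [hausdorffMeasure_levelSet_eq_zero ha0 hb0 ha_sum hb_sum ht htlim s.coe_nonneg hs]
    exact ENNReal.zero_ne_top
  · exact le_dimH_of_hausdorffMeasure_ne_zero
      (hausdorffMeasure_levelSet_ne_zero ha0 hb0 ha_sum hb_sum hq₁ hq₀ hle hs0 hs)
  · exact iSup_le_of_eq_zero (m := fun u => lowerHS u (levelSet (blockMeasure a b t) α))
      fun u hu => lowerHS_levelSet_eq_zero ha0 hb0 ha_sum hb_sum ht htlim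
        (hs.trans (NNReal.coe_lt_coe.2 hu))
  · exact le_iSup_of_le s (le_iSup_of_le
      (lowerHS_levelSet_eq_top ha0 hb0 ha_sum hb_sum hq₁ hq₀ hle hs) le_rfl)
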